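/- Let $k$ be a field of characteristic not $2$, let $K$ be a separable closure of $k$, and let $G_k=\operatorname{Gal}(K/k)$. Let $f,g\in k[x]$ be cubic polynomials, with leading coefficients $c$ and $c'$, such that $E: y^2=f(x)$ and $F: y^2=g(x)$ are elliptic curves, and let $\psi: E[2](K)\to F[2](K)$ be an isomorphism of $G_k$-modules. Put $L=k[T]/(f(T))$ and $L'=k[T]/(g(T))$. Define $\iota: E(k)\to L^*/L^{*2}$ as follows. - $\iota(O)=1$ for the point at infinity $O$. - If $P\in E(k)$ is not a $2$-torsion point, $\iota(P)$ is the class of $c(x_P-T)$. - If $P\in E(k)$ is a nonzero $2$-torsion point, write $f(T)=(T-x_P)h(T)$, so that $L\cong k\times k[T]/(h(T))$ via $T\mapsto(x_P,T)$. Then $\iota(P)$ is the class of the element with component $c\,h(x_P)$ in $k$ and $c(x_P-T)$ in $k[T]/(h(T))$. (The first component is the one, up to squares, for which the norm of the element to $k$ is a square.) For monic $f$ one has $c=1$, and $\iota$ is given by $x_P-T$. Define $\iota': F(k)\to L'^*/L'^{*2}$ in the same way from $g$ and $c'$. Let $A$ be the quotient of $E\times F$ by the graph of $\psi$; thus $A(K)=(E\times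 F)(K)/\operatorname{graph}(\psi)$ with the induced action of $G_k$, and the $k$-rational points of $A$ are the points of $A(K)$ fixed by $G_k$. The map $\psi$ induces an isomorphism $\tilde\psi: L'\to L$. That is, there is a unique isomorphism of $k$-algebras $\tilde\psi: L'\to L$ such that, for every nonzero $R\in E[2](K)$, the composition of $\tilde\psi$ with the $k$-algebra homomorphism $L\to K$, $T\mapsto x_R$, is the $k$-algebra homomorphism $L'\to K$, $T\mapsto x_{\psi(R)}$. Moreover: (a) If a point $(P_0,Q_0)$ of $(E\times F)(K)$ maps to a $k$-rational point of $A$, then $2P_0\in E(k)$ and $2Q_0\in F(k)$. (b) Given $P\in E(k)$ and $Q\in F(k)$, there exists a point $(P_0,Q_0)$ of $(E\times F)(K)$ that maps to a $k$-rational point of $A$ and such that $2P_0=P$ and $2Q_0=Q$, if and only if the isomorphism $L'^*/L'^{*2}\to L^*/L^{*2}$ induced by $\tilde\psi$ maps $\iota'(Q)$ to $\iota(P)$. -/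

import Mathlib

namespace TwoGluing

open Polynomial WeierstrassCurve

universe u v

/-- The elliptic curve `y² = f(x)` for a cubic `f = c x³ + a x² + b x + d`, in Weierstrass form
`Y² = X³ + a X² + c b X + c² d`, where `X = c x` and `Y = c y`.
For monic `f` this is literally `y² = f(x)`. -/
def cubicCurve {k : Type u} [Field k] (f : k[X]) : WeierstrassCurve k where
  a₁ := 0
  a₂ := f.coeff 2
  a₃ := 0
  a₄ := f.coeff 3 * f.coeff 1
  a₆ := f.coeff 3 ^ 2 * f.coeff 0

/-- The value of a cubic polynomial in terms of its coefficients. -/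
theorem aeval_cubic {k : Type u} [Field k] {F : Type v} [Field F] [Algebra k F] {f : k[X]}
    (hf : f.natDegree = 3) (x : F) :
    aeval x f = algebraMap k F (f.coeff 0) + algebraMap k F (f.coeff 1) * x
      + algebraMap k F (f.coeff 2) * x ^ 2 + algebraMap k F (f.coeff 3) * x ^ 3 := by
  rw [aeval_eq_sum_range, hf]
  simp [Finset.sum_range_succ, Algebra.smul_def]

theorem coeff_three_ne_zero {k : Type u} [Field k] {f : k[X]} (hf : f.natDegree = 3) :
    f.coeff 3 ≠ 0 := by
  have h0 : f ≠ 0 := by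
    rintro rfl
    simp at hf
  have h := leadingCoeff_ne_zero.mpr h0
  rwa [leadingCoeff, hf] at h

/-- Over every field extension `F` of `k`, the affine points of `cubicCurve f` are the points
`(c x, c y)` with `y² = f(x)`. -/
theorem cubicCurve_equation_iff {k : Type u} [Field k] {F : Type v} [Field F] [Algebra k F]
    {f : k[X]} (hf : f.natDegree = 3) (X Y : F) :
    ((cubicCurve f).toAffine.baseChange F).Equation X Y ↔
      (Y / algebraMap k F (f.coeff 3)) ^ 2 = aeval (X / algebraMap k F (f.coeff 3)) f := by
  have hc : algebraMap k F (f.coeff 3) ≠ 0 := by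
    simpa using coeff_three_ne_zero hf
  rw [Affine.equation_iff, aeval_cubic hf]
  simp only [Affine.baseChange, WeierstrassCurve.baseChange, WeierstrassCurve.map, cubicCurve,
    map_zero, map_mul, map_pow]
  field_simp
  constructor <;> intro h <;> linear_combination h

/-- The group `W(F)` of points of `W` over an extension field `F` of `k`. -/
abbrev Points {k : Type u} [Field k] (W : WeierstrassCurve k) (F : Type v) [Field F]
    [Algebra k F] : Type v :=
  (W.toAffine.baseChange F).Point

/-- The inclusion `W(k) → W(K)`. -/
noncomputable def ofBase {k : Type u} [Field k] (K : Type v) [Field K] [Algebra k K]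
    [DecidableEq k] [DecidableEq K] (W : WeierstrassCurve k) : Points W k →+ Points W K :=
  Affine.Point.map (W' := W.toAffine) (Algebra.ofId k K)

/-- The action of `σ ∈ Gal(K/k)` on `W(K)`. -/
noncomputable def galois {k : Type u} [Field k] {K : Type v} [Field K] [Algebra k K]
    [DecidableEq K] (W : WeierstrassCurve k) (σ : K ≃ₐ[k] K) : Points W K →+ Points W K :=
  Affine.Point.map (W' := W.toAffine) (σ : K →ₐ[k] K)

/-- The 2-torsion subgroup `W[2](K)`. -/
abbrev TwoTorsion {k : Type u} [Field k] (K : Type v) [Field K] [Algebra k K] [DecidableEq K]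
    (W : WeierstrassCurve k) : AddSubgroup (Points W K) :=
  AddSubgroup.torsionBy (Points W K) (2 : ℤ)

theorem mem_twoTorsion {k : Type u} [Field k] {K : Type v} [Field K] [Algebra k K]
    [DecidableEq K] {W : WeierstrassCurve k} {T : Points W K} :
    T ∈ TwoTorsion K W ↔ (2 : ℤ) • T = 0 := by
  rfl

/-- The action of `σ ∈ Gal(K/k)` on `W[2](K)`. -/
noncomputable def galoisTwoTorsion {k : Type u} [Field k] {K : Type v} [Field K] [Algebra k K]
    [DecidableEq K] (W : WeierstrassCurve k) (σ : K ≃ₐ[k] K) :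
    TwoTorsion K W →+ TwoTorsion K W :=
  ((galois W σ).comp (TwoTorsion K W).subtype).codRestrict (TwoTorsion K W) fun T => by
    have h : (2 : ℤ) • (T : Points W K) = 0 := mem_twoTorsion.mp T.2
    rw [mem_twoTorsion, AddMonoidHom.comp_apply, AddSubgroup.subtype_apply, ← map_zsmul, h,
      _root_.map_zero]

/-- Isomorphisms of Galois modules `V[2](K) → W[2](K)`. -/
structure TwoTorsionIso {k : Type u} [Field k] (K : Type v) [Field K] [Algebra k K]
    [DecidableEq K] (V W : WeierstrassCurve k) extends TwoTorsion K V ≃+ TwoTorsion K W where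
  map_galois : ∀ (σ : K ≃ₐ[k] K) (T : TwoTorsion K V),
    toFun (galoisTwoTorsion V σ T) = galoisTwoTorsion W σ (toFun T)

namespace TwoTorsionIso

variable {k : Type u} [Field k] {K : Type v} [Field K] [Algebra k K] [DecidableEq K]
  {V W : WeierstrassCurve k}

/-- The graph `{(T, ψ T) : T ∈ V[2](K)}` of `ψ`, as a subgroup of `(V × W)(K)`. -/
def graph (ψ : TwoTorsionIso K V W) : AddSubgroup (Points V K × Points W K) :=
  ((TwoTorsion K V).subtype.prod
    ((TwoTorsion K W).subtype.comp ψ.toAddEquiv.toAddMonoidHom)).range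

theorem mem_graph (ψ : TwoTorsionIso K V W) (x : Points V K × Points W K) :
    x ∈ ψ.graph ↔
      ∃ T : TwoTorsion K V, ((T : Points V K), (ψ.toAddEquiv T : Points W K)) = x := by
  rfl

/-- `A(K)`, where `A` is the quotient of `V × W` by the graph of `ψ`. For `K` separably closed of
characteristic not 2 the graph is a finite étale group scheme, so the map `(V × W)(K) → A(K)` is
surjective with kernel the graph. -/
abbrev Quotient (ψ : TwoTorsionIso K V W) : Type v :=
  (Points V K × Points W K) ⧸ ψ.graph

theorem graph_le_comap (ψ : TwoTorsionIso K V W) (σ : K ≃ₐ[k] K) :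
    ψ.graph ≤ ψ.graph.comap ((galois V σ).prodMap (galois W σ)) := by
  intro x hx
  obtain ⟨T, rfl⟩ := (ψ.mem_graph x).mp hx
  rw [AddSubgroup.mem_comap, mem_graph]
  refine ⟨galoisTwoTorsion V σ T, Prod.ext rfl ?_⟩
  exact congrArg Subtype.val (ψ.map_galois σ T)

/-- The action of `σ ∈ Gal(K/k)` on `A(K)`, induced by the diagonal action on `(V × W)(K)`. -/
noncomputable def galoisQuotient (ψ : TwoTorsionIso K V W) (σ : K ≃ₐ[k] K) : ψ.Quotient →+ ψ.Quotient :=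
  QuotientAddGroup.map ψ.graph ψ.graph ((galois V σ).prodMap (galois W σ)) (ψ.graph_le_comap σ)

/-- A point of `A(K)` is `k`-rational if it is fixed by `Gal(K/k)`. -/
def IsRational (ψ : TwoTorsionIso K V W) (a : ψ.Quotient) : Prop :=
  ∀ σ : K ≃ₐ[k] K, ψ.galoisQuotient σ a = a

/-- The quotient map `(V × W)(K) → A(K)`. -/
def proj (ψ : TwoTorsionIso K V W) : Points V K × Points W K →+ ψ.Quotient :=
  QuotientAddGroup.mk' ψ.graph

end TwoTorsionIso

/-- The `x`-coordinate on the model `y² = f(x)` of a point of `cubicCurve f`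
(and `0`, without meaning, for the point at infinity). -/
def xCoord {k : Type u} [Field k] (f : k[X]) {F : Type v} [Field F] [Algebra k F] :
    Points (cubicCurve f) F → F
  | .zero => 0
  | .some X _ _ => X / algebraMap k F (f.coeff 3)

/-- Nonzero 2-torsion points of `y² = f(x)` are of the form `(e, 0)` with `f(e) = 0`. -/
theorem aeval_xCoord_twoTorsion {k : Type u} [Field k] {K : Type v} [Field K] [Algebra k K]
    [DecidableEq K] (h2 : (2 : k) ≠ 0) {f : k[X]} (hf : f.natDegree = 3)
    (T : TwoTorsion K (cubicCurve f)) (hT : T ≠ 0) :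
    aeval (xCoord f (T : Points (cubicCurve f) K)) f = 0 := by
  obtain ⟨T, hmem⟩ := T
  have hz : (2 : ℤ) • T = 0 := mem_twoTorsion.mp hmem
  rcases T with _ | ⟨X, Y, h⟩
  · exact absurd rfl hT
  · have hneg := eq_neg_of_add_eq_zero_left ((two_zsmul _).symm.trans hz)
    rw [Affine.Point.neg_some, Affine.Point.some.injEq] at hneg
    have h2K : (2 : K) ≠ 0 := by
      rw [← map_ofNat (algebraMap k K) 2]
      exact (map_ne_zero (algebraMap k K)).mpr h2
    have hY : Y = 0 := by
      have h' := hneg.2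
      simp only [Affine.negY, Affine.baseChange, WeierstrassCurve.baseChange,
        WeierstrassCurve.map, cubicCurve, _root_.map_zero, zero_mul, sub_zero] at h'
      have : 2 * Y = 0 := by linear_combination h'
      exact (mul_eq_zero.mp this).resolve_left h2K
    have heq := (cubicCurve_equation_iff hf X Y).mp h.1
    rw [hY] at heq
    change aeval (X / algebraMap k K (f.coeff 3)) f = 0
    rw [← heq]
    simp

/-- The `k`-algebra homomorphism `L = k[T]/(f) → K`, `T ↦ x(P)`, attached to a nonzero 2-torsion
point `P`; this is the identification of `E[2] \ {0}` with the geometric points of `Spec L`. -/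
noncomputable def evalAt {k : Type u} [Field k] {K : Type v} [Field K] [Algebra k K]
    [DecidableEq K] (h2 : (2 : k) ≠ 0) {f : k[X]} (hf : f.natDegree = 3)
    (P : TwoTorsion K (cubicCurve f)) (hP : P ≠ 0) : AdjoinRoot f →ₐ[k] K :=
  AdjoinRoot.liftAlgHom f (Algebra.ofId k K) (xCoord f (P : Points (cubicCurve f) K))
    (aeval_xCoord_twoTorsion h2 hf P hP)

/-- `θ : L' → L` is the isomorphism induced by `ψ : E[2] → F[2]`, i.e. on geometric points
`E[2] \ {0} = Spec L (K)` and `F[2] \ {0} = Spec L' (K)` it is given by `ψ`. -/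
def IsInducedBy {k : Type u} [Field k] {K : Type v} [Field K] [Algebra k K] [DecidableEq K]
    (h2 : (2 : k) ≠ 0) {f g : k[X]} (hf : f.natDegree = 3) (hg : g.natDegree = 3)
    (ψ : TwoTorsionIso K (cubicCurve f) (cubicCurve g))
    (θ : AdjoinRoot g ≃ₐ[k] AdjoinRoot f) : Prop :=
  ∀ (T : TwoTorsion K (cubicCurve f)) (hT : T ≠ 0) (a : AdjoinRoot g),
    evalAt h2 hf T hT (θ a) =
      evalAt h2 hg (ψ.toAddEquiv T) ((EmbeddingLike.map_ne_zero_iff).mpr hT) a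

/-- The group `R*/R*²`. -/
abbrev UnitsModSquares (R : Type u) [CommRing R] : Type u :=
  Rˣ ⧸ (powMonoidHom 2 : Rˣ →* Rˣ).range

/-- The homomorphism `R*/R*² → S*/S*²` induced by a ring homomorphism `R → S`. -/
def UnitsModSquares.map {R S : Type u} [CommRing R] [CommRing S] (φ : R →+* S) :
    UnitsModSquares R →* UnitsModSquares S :=
  QuotientGroup.map _ _ (Units.map (φ : R →* S)) (by
    rintro _ ⟨a, rfl⟩
    exact ⟨Units.map (φ : R →* S) a, by simp⟩)

/-- A polynomial representing the Kummer image of the point of `y² = f(x)` with `x`-coordinate `x`,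
where `f` has leading coefficient `c` and `T` is the variable.
If the point is not 2-torsion, it is `c (x - T)`.
If the point is 2-torsion, so that `f = (T - x) h`, it is `c (x - T) + c h(T)`, which is `c (x - T)`
in all components of `L` but the one where `T = x`, and is `c h(x)` in that component;
this is the value for which the norm to `k` is a square. -/
noncomputable def kummerPoly {k : Type u} [Field k] [DecidableEq k] (f : k[X]) (x : k) : k[X] :=
  if f.eval x = 0 then C (f.coeff 3) * (C x - X) + C (f.coeff 3) * (f /ₘ (X - C x))
  else C (f.coeff 3) * (C x - X)

theorem eval_derivative_ne_zero {k : Type u} [Field k] {f : k[X]} (hf : f.natDegree = 3)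
    [(cubicCurve f).IsElliptic] {x : k} (hx : f.eval x = 0) : f.derivative.eval x ≠ 0 := by
  have hc := coeff_three_ne_zero hf
  have hfx : f = C (f.coeff 0) + C (f.coeff 1) * X + C (f.coeff 2) * X ^ 2
      + C (f.coeff 3) * X ^ 3 := by
    conv_lhs => rw [f.as_sum_range_C_mul_X_pow, hf]
    simp [Finset.sum_range_succ]
  have hd : f.derivative.eval x = f.coeff 1 + 2 * f.coeff 2 * x + 3 * f.coeff 3 * x ^ 2 := by
    conv_lhs => rw [hfx]
    simp
    ring
  have he : f.coeff 0 + f.coeff 1 * x + f.coeff 2 * x ^ 2 + f.coeff 3 * x ^ 3 = 0 := by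
    have h := aeval_cubic (F := k) hf x
    rw [coe_aeval_eq_eval, hx] at h
    simpa using h.symm
  have hE : (cubicCurve f).toAffine.Equation (f.coeff 3 * x) 0 := by
    rw [Affine.equation_iff]
    simp only [cubicCurve]
    linear_combination (-(f.coeff 3) ^ 2) * he
  have hN := (Affine.equation_iff_nonsingular (W := (cubicCurve f).toAffine)).mp hE
  rw [Affine.nonsingular_iff] at hN
  intro h0
  rw [hd] at h0
  rcases hN.2 with h | h
  · apply h
    simp only [cubicCurve]
    linear_combination (-(f.coeff 3)) * h0
  · apply h
    simp [cubicCurve]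

theorem isCoprime_kummerPoly {k : Type u} [Field k] [DecidableEq k] {f : k[X]}
    (hf : f.natDegree = 3) [(cubicCurve f).IsElliptic] (x : k) :
    IsCoprime (kummerPoly f x) f := by
  have hc : IsUnit (C (f.coeff 3)) := isUnit_C.mpr (coeff_three_ne_zero hf).isUnit
  have key : ∀ p : k[X], p.eval x ≠ 0 → IsCoprime (X - C x) p := fun p hp =>
    ((irreducible_X_sub_C x).coprime_iff_not_dvd).mpr fun h => hp (dvd_iff_isRoot.mp h)
  unfold kummerPoly
  split_ifs with hx
  · have hmul : (X - C x) * (f /ₘ (X - C x)) = f := mul_divByMonic_eq_iff_isRoot.mpr hx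
    set h := f /ₘ (X - C x)
    have hh : h.eval x ≠ 0 := by
      have hd := eval_derivative_ne_zero hf hx
      rw [← hmul] at hd
      simpa using hd
    have h1 : IsCoprime (X - C x) h := key h hh
    rw [← mul_add]
    refine (isCoprime_mul_unit_left_left hc _ _).mpr ?_
    rw [← hmul]
    refine IsCoprime.mul_right ?_ ?_
    · have : C x - X + h = h + (X - C x) * (-1) := by ring
      rw [this]
      exact h1.symm.add_mul_left_left (-1)
    · have : C x - X + h = -(X - C x) + h * 1 := by ring
      rw [this]
      exact h1.neg_left.add_mul_left_left 1
  · refine (isCoprime_mul_unit_left_left hc _ _).mpr ?_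
    rw [← neg_sub]
    exact (key f hx).neg_left

theorem isUnit_mk_kummerPoly {k : Type u} [Field k] [DecidableEq k] {f : k[X]}
    (hf : f.natDegree = 3) [(cubicCurve f).IsElliptic] (x : k) :
    IsUnit (AdjoinRoot.mk f (kummerPoly f x)) := by
  obtain ⟨a, b, hab⟩ := isCoprime_kummerPoly hf x
  refine IsUnit.of_mul_eq_one (AdjoinRoot.mk f a) ?_
  have h := congrArg (AdjoinRoot.mk f) hab
  rw [map_add, map_mul, map_mul, AdjoinRoot.mk_self, mul_zero, add_zero, map_one] at h
  rw [mul_comm, h]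

/-- The Kummer map `ι : E(k) → L*/L*²` of `E : y² = f(x)`, with `L = k[T]/(f)`. -/
noncomputable def kummer {k : Type u} [Field k] [DecidableEq k] {f : k[X]}
    (hf : f.natDegree = 3) [(cubicCurve f).IsElliptic] :
    Points (cubicCurve f) k → UnitsModSquares (AdjoinRoot f)
  | .zero => 1
  | .some X Y h => QuotientGroup.mk (isUnit_mk_kummerPoly hf (xCoord f (.some X Y h))).unit

end TwoGluing

/-! A point of A(K) represented by (P₀, Q₀) is rational exactly when, for every σ, the difference
σP₀ - P₀ lies in E[2] and ψ carries it to σQ₀ - Q₀. Doubling kills these differences, which gives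
(a). For (b), the question is whether halves of P and Q can be chosen whose Kummer cocycles
correspond under ψ.

The cocycles are made explicit by functions instead of cohomology. For a nonzero 2-torsion point T
there is a function on E whose square is X(2P₀) - X(T); translation by a 2-torsion point S
multiplies it by the Weil pairing of S and T. `kummerRoot` is this function with its zeros and poles
replaced by values that keep the translation law (`kummerRoot_add`). Its square at a half of P is
the component at T of ι(P), in both the generic and the 2-torsion case (`exists_kummer_eq_mk`). An
isomorphism E[2] ≅ F[2] preserves the Weil pairing automatically, since the pairing depends only on
whether S is 0, T or another point.

If the cocycles correspond, the pairing factors cancel in the quotient of the square roots for P₀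
and Q₀. The quotient is then an equivariant function of T and descends to a unit of L
(`exists_evalAt_eq`), whose square compares ι(P) with the image of ι'(Q). Conversely, an equality of
classes determines the square roots up to a sign for each T. Among the eight sign functions on three
points, four are pairings with a 2-torsion point S and the others are their negatives
(`exists_kummerRoot_eq_sign`). Replacing P₀ by P₀ + S leaves a constant sign, which Galois fixes,
and nondegeneracy of the pairing then identifies the cocycles. -/

namespace TwoGluing

open Polynomial WeierstrassCurve

/-! ### Split Weierstrass cubics: explicit halving and the Kummer square root -/

section SplitCurve

variable {F : Type*} [Field F]

/-- The curve `V` is `y² = (x - e₁) (x - e₂) (x - e₃)` with distinct `e₁`, `e₂`, `e₃`. -/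
structure IsSplit (V : Affine F) (e₁ e₂ e₃ : F) : Prop where
  a₁ : V.a₁ = 0
  a₃ : V.a₃ = 0
  a₂ : V.a₂ = -(e₁ + e₂ + e₃)
  a₄ : V.a₄ = e₁ * e₂ + e₁ * e₃ + e₂ * e₃
  a₆ : V.a₆ = -(e₁ * e₂ * e₃)
  ne₁₂ : e₁ ≠ e₂
  ne₁₃ : e₁ ≠ e₃
  ne₂₃ : e₂ ≠ e₃

variable {V : Affine F} {e₁ e₂ e₃ : F}

namespace IsSplit

theorem swap (h : IsSplit V e₁ e₂ e₃) : IsSplit V e₂ e₁ e₃ where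
  a₁ := h.a₁
  a₃ := h.a₃
  a₂ := by rw [h.a₂]; ring
  a₄ := by rw [h.a₄]; ring
  a₆ := by rw [h.a₆]; ring
  ne₁₂ := h.ne₁₂.symm
  ne₁₃ := h.ne₂₃
  ne₂₃ := h.ne₁₃

theorem rotate (h : IsSplit V e₁ e₂ e₃) : IsSplit V e₂ e₃ e₁ where
  a₁ := h.a₁
  a₃ := h.a₃
  a₂ := by rw [h.a₂]; ring
  a₄ := by rw [h.a₄]; ring
  a₆ := by rw [h.a₆]; ring
  ne₁₂ := h.ne₂₃
  ne₁₃ := h.ne₁₂.symm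
  ne₂₃ := h.ne₁₃.symm

theorem equation_iff (h : IsSplit V e₁ e₂ e₃) (x y : F) :
    V.Equation x y ↔ y ^ 2 = (x - e₁) * (x - e₂) * (x - e₃) := by
  rw [Affine.equation_iff, h.a₁, h.a₂, h.a₃, h.a₄, h.a₆]
  constructor <;> intro H <;> linear_combination H

theorem negY (h : IsSplit V e₁ e₂ e₃) (x y : F) : V.negY x y = -y := by
  rw [Affine.negY, h.a₁, h.a₃]; ring

theorem equation_zero_iff (h : IsSplit V e₁ e₂ e₃) (x : F) :
    V.Equation x 0 ↔ x = e₁ ∨ x = e₂ ∨ x = e₃ := by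
  rw [h.equation_iff, zero_pow two_ne_zero, eq_comm]
  simp only [mul_eq_zero, sub_eq_zero, or_assoc]

theorem nonsingular (h2 : (2 : F) ≠ 0) (h : IsSplit V e₁ e₂ e₃) {x y : F} (hxy : V.Equation x y) :
    V.Nonsingular x y := by
  rw [Affine.nonsingular_iff]
  refine ⟨hxy, ?_⟩
  rw [h.a₁, h.a₂, h.a₃, h.a₄]
  by_cases hy : y = 0
  · subst hy
    left
    have h12 := sub_ne_zero.mpr h.ne₁₂
    have h13 := sub_ne_zero.mpr h.ne₁₃
    have h23 := sub_ne_zero.mpr h.ne₂₃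
    rcases (h.equation_zero_iff x).mp hxy with rfl | rfl | rfl <;> intro H
    · exact mul_ne_zero h12 h13 (by linear_combination -H)
    · exact mul_ne_zero h12 h23 (by linear_combination H)
    · exact mul_ne_zero h13 h23 (by linear_combination -H)
  · right
    intro H
    exact mul_ne_zero h2 hy (by linear_combination H)

/-- A root of the cubic can be listed first. -/
theorem exists_first (h : IsSplit V e₁ e₂ e₃) {e : F} (he : V.Equation e 0) :
    ∃ e' e'', IsSplit V e e' e'' := by
  rcases (h.equation_zero_iff e).mp he with rfl | rfl | rfl
  exacts [⟨_, _, h⟩, ⟨_, _, h.swap⟩, ⟨_, _, h.rotate.rotate⟩]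

/-- Two distinct roots of the cubic can be listed first. -/
theorem exists_third (h : IsSplit V e₁ e₂ e₃) {e t : F} (he : V.Equation e 0)
    (ht : V.Equation t 0) (hne : e ≠ t) : ∃ s, IsSplit V e t s := by
  obtain ⟨e', e'', h'⟩ := h.exists_first he
  rcases (h'.equation_zero_iff t).mp ht with rfl | rfl | rfl
  exacts [absurd rfl hne, ⟨_, h'⟩, ⟨_, h'.rotate.rotate.swap⟩]

theorem derivative_eq (h : IsSplit V e₁ e₂ e₃) :
    3 * e₁ ^ 2 + 2 * V.a₂ * e₁ + V.a₄ = (e₁ - e₂) * (e₁ - e₃) := by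
  rw [h.a₂, h.a₄]; ring

theorem sub_ne_zero_of_Y_ne (h : IsSplit V e₁ e₂ e₃) {x y : F} (hP : V.Nonsingular x y)
    (hy : y ≠ 0) : x - e₁ ≠ 0 ∧ x - e₂ ≠ 0 ∧ x - e₃ ≠ 0 := by
  have := (h.equation_iff x y).mp hP.1
  have h0 : (x - e₁) * (x - e₂) * (x - e₃) ≠ 0 := this ▸ pow_ne_zero 2 hy
  simpa [and_assoc] using h0

variable [DecidableEq F]

/-- The slope and the sum enter as variables subject to equations, so each use can supply its own
closed forms. -/
theorem add_some_of_X_ne (h : IsSplit V e₁ e₂ e₃) {x₁ y₁ x₂ y₂ m x₃ y₃ : F}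
    (h₁ : V.Nonsingular x₁ y₁) (h₂ : V.Nonsingular x₂ y₂) (hx : x₁ ≠ x₂)
    (hm : m * (x₁ - x₂) = y₁ - y₂) (hx₃ : x₃ = m ^ 2 + (e₁ + e₂ + e₃) - x₁ - x₂)
    (hy₃ : y₃ = m * (x₁ - x₃) - y₁) :
    ∃ h₃ : V.Nonsingular x₃ y₃, Affine.Point.some x₁ y₁ h₁ + .some x₂ y₂ h₂ = .some x₃ y₃ h₃ := by
  have hs : V.slope x₁ x₂ y₁ y₂ = m := by
    rw [Affine.slope_of_X_ne hx, div_eq_iff (sub_ne_zero.mpr hx), hm]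
  have hX : V.addX x₁ x₂ m = x₃ := by
    rw [Affine.addX, h.a₁, h.a₂, hx₃]; ring
  have hY : V.addY x₁ x₂ y₁ m = y₃ := by
    rw [Affine.addY, Affine.negAddY, h.negY, hX, hy₃]; ring
  have key := Affine.Point.add_of_X_ne (W := V) (h₁ := h₁) (h₂ := h₂) hx
  have h3 := Affine.nonsingular_add h₁ h₂ fun H => hx H.1
  simp only [hs, hX, hY] at key h3
  exact ⟨h3, key⟩

theorem two_nsmul_some (h2 : (2 : F) ≠ 0) (h : IsSplit V e₁ e₂ e₃) {x₁ y₁ m x₃ y₃ : F}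
    (h₁ : V.Nonsingular x₁ y₁) (hy : y₁ ≠ 0)
    (hm : m * (2 * y₁) = (x₁ - e₁) * (x₁ - e₂) + (x₁ - e₁) * (x₁ - e₃) + (x₁ - e₂) * (x₁ - e₃))
    (hx₃ : x₃ = m ^ 2 + (e₁ + e₂ + e₃) - 2 * x₁) (hy₃ : y₃ = m * (x₁ - x₃) - y₁) :
    ∃ h₃ : V.Nonsingular x₃ y₃, 2 • Affine.Point.some x₁ y₁ h₁ = .some x₃ y₃ h₃ := by
  have hne : y₁ ≠ V.negY x₁ y₁ := by
    rw [h.negY]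
    intro H
    exact mul_ne_zero h2 hy (by linear_combination H)
  have hs : V.slope x₁ x₁ y₁ y₁ = m := by
    rw [Affine.slope_of_Y_ne rfl hne, h.negY, h.a₁, h.a₂, h.a₄,
      div_eq_iff (by simpa [← two_mul] using And.intro h2 hy)]
    linear_combination -hm
  have hX : V.addX x₁ x₁ m = x₃ := by
    rw [Affine.addX, h.a₁, h.a₂, hx₃]; ring
  have hY : V.addY x₁ x₁ y₁ m = y₃ := by
    rw [Affine.addY, Affine.negAddY, h.negY, hX, hy₃]; ring
  have key := Affine.Point.add_self_of_Y_ne (W := V) (h₁ := h₁) hne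
  have h3 := Affine.nonsingular_add h₁ h₁ fun H => hne H.2
  simp only [hs, hX, hY] at key h3
  exact ⟨h3, by rw [two_nsmul, key]⟩

theorem two_nsmul_some_eq_zero_iff (h2 : (2 : F) ≠ 0) (h : IsSplit V e₁ e₂ e₃) {x y : F}
    (hP : V.Nonsingular x y) : 2 • Affine.Point.some x y hP = 0 ↔ y = 0 := by
  rw [two_nsmul, add_eq_zero_iff_eq_neg, Affine.Point.neg_some, Affine.Point.some.injEq, h.negY]
  constructor
  · rintro ⟨-, H⟩
    exact (mul_eq_zero.mp (by linear_combination H : 2 * y = 0)).resolve_left h2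
  · rintro rfl
    simp

/-- Halving: every point is divisible by `2` if `F` is closed under square roots. -/
theorem exists_two_nsmul (h2 : (2 : F) ≠ 0) (hsq : ∀ a : F, ∃ r, a = r * r)
    (h : IsSplit V e₁ e₂ e₃) (P : V.Point) : ∃ P₀ : V.Point, 2 • P₀ = P := by
  rcases P with _ | ⟨x, y, hP⟩
  · exact ⟨0, smul_zero 2⟩
  obtain ⟨r₁, hr₁⟩ := hsq (x - e₁)
  obtain ⟨r₂, hr₂⟩ := hsq (x - e₂)
  have heq := (h.equation_iff x y).mp hP.1
  -- The product of the three roots is y up to sign; the sign of r₃ is chosen to make it y.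
  obtain ⟨r₃, hr₃, hy⟩ : ∃ r₃, x - e₃ = r₃ * r₃ ∧ y = r₁ * r₂ * r₃ := by
    obtain ⟨r₃, hr₃⟩ := hsq (x - e₃)
    have : (y - r₁ * r₂ * r₃) * (y + r₁ * r₂ * r₃) = 0 := by
      rw [hr₁, hr₂, hr₃] at heq
      linear_combination heq
    rcases mul_eq_zero.mp this with H | H
    · exact ⟨r₃, hr₃, by linear_combination H⟩
    · exact ⟨-r₃, by rw [hr₃]; ring, by linear_combination H⟩
  -- Classical halving formula: each x₀ - eᵢ factors into sums of the r's, and the tangent at (x₀,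
  -- y₀) has slope r₁ + r₂ + r₃.
  set x₀ := x + r₁ * r₂ + r₁ * r₃ + r₂ * r₃ with hx₀
  set y₀ := (r₁ + r₂) * (r₁ + r₃) * (r₂ + r₃) with hy₀
  have k₁ : x₀ - e₁ = (r₁ + r₂) * (r₁ + r₃) := by linear_combination hx₀ + hr₁
  have k₂ : x₀ - e₂ = (r₁ + r₂) * (r₂ + r₃) := by linear_combination hx₀ + hr₂
  have k₃ : x₀ - e₃ = (r₁ + r₃) * (r₂ + r₃) := by linear_combination hx₀ + hr₃
  have hy₀0 : y₀ ≠ 0 := by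
    -- If rᵢ = -rⱼ, then rᵢ and rⱼ have the same square, forcing eᵢ = eⱼ.
    refine mul_ne_zero (mul_ne_zero ?_ ?_) ?_ <;> intro H
    · exact h.ne₁₂ (by linear_combination hr₂ - hr₁ + (r₂ - r₁) * H)
    · exact h.ne₁₃ (by linear_combination hr₃ - hr₁ + (r₃ - r₁) * H)
    · exact h.ne₂₃ (by linear_combination hr₃ - hr₂ + (r₃ - r₂) * H)
  have hE : V.Equation x₀ y₀ := by
    rw [h.equation_iff, k₁, k₂, k₃, hy₀]; ring
  obtain ⟨_, H⟩ := h.two_nsmul_some h2 (h.nonsingular h2 hE) hy₀0 (m := r₁ + r₂ + r₃) (x₃ := x)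
    (y₃ := y) (by rw [k₁, k₂, k₃, hy₀]; ring) (by linear_combination 2 * hx₀ + hr₁ + hr₂ + hr₃)
    (by rw [hy, hx₀, hy₀]; ring)
  exact ⟨_, H⟩

end IsSplit

variable [DecidableEq F]

/-- For a root `e` of the cubic and a point `P₀`, a square root of the component at `e` of the
Kummer image of `2 P₀`. On 2-torsion points it is the Weil pairing with `(e, 0)`. -/
def kummerRoot (V : Affine F) (e : F) : V.Point → F
  | .zero => 1
  | .some x y _ =>
    if y = 0 then if x = e then 1 else -1
    -- This condition means that the double is (e, 0), where the generic quotient vanishes; x - e is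
    -- then a square root of the derivative of the cubic at e.
    else if (x - e) ^ 2 = 3 * e ^ 2 + 2 * V.a₂ * e + V.a₄ then x - e
    else ((x - e) ^ 2 - (3 * e ^ 2 + 2 * V.a₂ * e + V.a₄)) / (2 * y)

theorem kummerRoot_zero (V : Affine F) (e : F) : kummerRoot V e 0 = 1 := rfl

theorem kummerRoot_some_zero {e x : F} (hP : V.Nonsingular x 0) :
    kummerRoot V e (.some x 0 hP) = if x = e then 1 else -1 := by
  simp [kummerRoot]

namespace IsSplit

theorem kummerRoot_some (h : IsSplit V e₁ e₂ e₃) {x y : F} (hP : V.Nonsingular x y) (hy : y ≠ 0) :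
    kummerRoot V e₁ (.some x y hP) =
      if (x - e₁) ^ 2 = (e₁ - e₂) * (e₁ - e₃) then x - e₁
      else ((x - e₁) ^ 2 - (e₁ - e₂) * (e₁ - e₃)) / (2 * y) := by
  simp only [kummerRoot, if_neg hy, h.derivative_eq]

/-- Addition of two distinct nonzero 2-torsion points. -/
theorem some_zero_add (h : IsSplit V e₁ e₂ e₃) (h₁ : V.Nonsingular e₁ 0)
    (h₂ : V.Nonsingular e₂ 0) :
    ∃ h₃ : V.Nonsingular e₃ 0, Affine.Point.some e₁ 0 h₁ + .some e₂ 0 h₂ = .some e₃ 0 h₃ :=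
  h.add_some_of_X_ne h₁ h₂ h.ne₁₂ (m := 0) (by ring) (by ring) (by ring)

theorem some_zero_add_self (h : IsSplit V e₁ e₂ e₃) {t : F} (ht : V.Nonsingular t 0) :
    Affine.Point.some t 0 ht + .some t 0 ht = 0 :=
  Affine.Point.add_self_of_Y_eq (by rw [h.negY, neg_zero])

/-- Addition of the 2-torsion point `(e₁, 0)`. -/
theorem add_some_zero (h : IsSplit V e₁ e₂ e₃) {x y : F} (hP : V.Nonsingular x y) (hy : y ≠ 0)
    (h₁ : V.Nonsingular e₁ 0) :
    ∃ h₃ : V.Nonsingular (e₁ + (e₁ - e₂) * (e₁ - e₃) / (x - e₁))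
        (-((e₁ - e₂) * (e₁ - e₃) * y) / (x - e₁) ^ 2),
      Affine.Point.some x y hP + .some e₁ 0 h₁ = .some _ _ h₃ := by
  obtain ⟨hx, -, -⟩ := h.sub_ne_zero_of_Y_ne hP hy
  have heq := (h.equation_iff x y).mp hP.1
  have hX : e₁ + (e₁ - e₂) * (e₁ - e₃) / (x - e₁)
      = (y / (x - e₁)) ^ 2 + (e₁ + e₂ + e₃) - x - e₁ := by
    rw [div_pow, heq]
    field_simp
    ring
  refine h.add_some_of_X_ne hP h₁ (sub_ne_zero.mp hx) (m := y / (x - e₁)) ?_ hX ?_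
  · field_simp; ring
  · field_simp; ring

/-- The pairing of (e₁, 0) with itself is trivial. With u = x - e₁ and B = (e₁ - e₂)(e₁ - e₃),
translation is u ↦ B/u, y ↦ -By/u², which fixes (u² - B)/(2y), and also fixes u when u² = B. -/
theorem kummerRoot_add_self (h2 : (2 : F) ≠ 0) (h : IsSplit V e₁ e₂ e₃)
    (h₁ : V.Nonsingular e₁ 0) (P : V.Point) :
    kummerRoot V e₁ (P + .some e₁ 0 h₁) = kummerRoot V e₁ P := by
  rcases P with _ | ⟨x, y, hP⟩
  · rw [← Affine.Point.zero_def, zero_add, kummerRoot_some_zero, if_pos rfl, kummerRoot_zero]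
  have n12 := sub_ne_zero.mpr h.ne₁₂
  have n13 := sub_ne_zero.mpr h.ne₁₃
  by_cases hy : y = 0
  · subst hy
    rcases (h.equation_zero_iff x).mp hP.1 with rfl | rfl | rfl
    · rw [h.some_zero_add_self, kummerRoot_zero, kummerRoot_some_zero, if_pos rfl]
    · obtain ⟨h₃, H⟩ := h.swap.some_zero_add hP h₁
      rw [H, kummerRoot_some_zero, kummerRoot_some_zero, if_neg h.ne₁₃.symm, if_neg h.ne₁₂.symm]
    · obtain ⟨h₃, H⟩ := h.rotate.rotate.some_zero_add hP h₁
      rw [H, kummerRoot_some_zero, kummerRoot_some_zero, if_neg h.ne₁₃.symm, if_neg h.ne₁₂.symm]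
  · obtain ⟨hx, -, -⟩ := h.sub_ne_zero_of_Y_ne hP hy
    obtain ⟨h₃, H⟩ := h.add_some_zero hP hy h₁
    have hy3 : -((e₁ - e₂) * (e₁ - e₃) * y) / (x - e₁) ^ 2 ≠ 0 :=
      div_ne_zero (neg_ne_zero.mpr (mul_ne_zero (mul_ne_zero n12 n13) hy)) (pow_ne_zero 2 hx)
    rw [H, h.kummerRoot_some h₃ hy3, h.kummerRoot_some hP hy, add_sub_cancel_left]
    have hB : (e₁ - e₂) * (e₁ - e₃) ≠ 0 := mul_ne_zero n12 n13
    generalize (e₁ - e₂) * (e₁ - e₃) = B at hB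
    generalize x - e₁ = u at hx
    have hiff : (B / u) ^ 2 = B ↔ u ^ 2 = B := by
      rw [div_pow, div_eq_iff (pow_ne_zero 2 hx), sq B, mul_right_inj' hB, eq_comm]
    by_cases hu : u ^ 2 = B
    · rw [if_pos hu, if_pos (hiff.mpr hu), ← hu]
      field_simp
    · rw [if_neg hu, if_neg (hiff.not.mpr hu)]
      field_simp
      ring

/-- Distinct nonzero 2-torsion points pair to -1. Translation scales the numerator and y by factors
that differ only in sign; the exceptional branch is preserved because its defining difference is
merely rescaled. -/
theorem kummerRoot_add_of_ne (h2 : (2 : F) ≠ 0) (h : IsSplit V e₁ e₂ e₃)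
    (h₁ : V.Nonsingular e₂ 0) (P : V.Point) :
    kummerRoot V e₁ (P + .some e₂ 0 h₁) = -kummerRoot V e₁ P := by
  rcases P with _ | ⟨x, y, hP⟩
  · rw [← Affine.Point.zero_def, zero_add, kummerRoot_some_zero, if_neg h.ne₁₂.symm,
      kummerRoot_zero]
  have n12 := sub_ne_zero.mpr h.ne₁₂
  have n13 := sub_ne_zero.mpr h.ne₁₃
  have n23 := sub_ne_zero.mpr h.ne₂₃
  have n21 := sub_ne_zero.mpr h.ne₁₂.symm
  by_cases hy : y = 0
  · subst hy
    rcases (h.equation_zero_iff x).mp hP.1 with rfl | rfl | rfl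
    · obtain ⟨h₃, H⟩ := h.some_zero_add hP h₁
      rw [H, kummerRoot_some_zero, kummerRoot_some_zero, if_neg h.ne₁₃.symm, if_pos rfl]
    · rw [h.some_zero_add_self, kummerRoot_zero, kummerRoot_some_zero, if_neg h.ne₁₂.symm, neg_neg]
    · obtain ⟨h₃, H⟩ := h.rotate.swap.some_zero_add hP h₁
      rw [H, kummerRoot_some_zero, kummerRoot_some_zero, if_neg h.ne₁₃.symm, if_pos rfl, neg_neg]
  · obtain ⟨hx1, hx, hx3⟩ := h.sub_ne_zero_of_Y_ne hP hy
    obtain ⟨h₃, H⟩ := h.swap.add_some_zero hP hy h₁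
    have hy3 : -((e₂ - e₁) * (e₂ - e₃) * y) / (x - e₂) ^ 2 ≠ 0 :=
      div_ne_zero (neg_ne_zero.mpr (mul_ne_zero (mul_ne_zero n21 n23) hy)) (pow_ne_zero 2 hx)
    have hX : e₂ + (e₂ - e₁) * (e₂ - e₃) / (x - e₂) - e₁
        = (e₂ - e₁) * (x - e₃) / (x - e₂) := by
      field_simp
      ring
    have hsub : ((e₂ - e₁) * (x - e₃) / (x - e₂)) ^ 2 - (e₁ - e₂) * (e₁ - e₃)
        = (e₂ - e₁) * (e₂ - e₃) / (x - e₂) ^ 2 * ((x - e₁) ^ 2 - (e₁ - e₂) * (e₁ - e₃)) := by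
      field_simp
      ring
    rw [H, h.kummerRoot_some h₃ hy3, h.kummerRoot_some hP hy, hX]
    by_cases hu : (x - e₁) ^ 2 = (e₁ - e₂) * (e₁ - e₃)
    · rw [if_pos hu, if_pos (by rw [← sub_eq_zero, hsub, hu, sub_self, mul_zero])]
      rw [div_eq_iff hx]
      linear_combination hu
    · have hu' := sub_ne_zero.mpr hu
      rw [if_neg hu, if_neg (by
        rw [← sub_eq_zero, hsub]
        exact mul_ne_zero (div_ne_zero (mul_ne_zero n21 n23) (pow_ne_zero 2 hx)) hu'), hsub]
      field_simp

theorem kummerRoot_add (h2 : (2 : F) ≠ 0) (h : IsSplit V e₁ e₂ e₃) {e : F} (he : V.Equation e 0)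
    (P T : V.Point) (hT : 2 • T = 0) :
    kummerRoot V e (P + T) = kummerRoot V e T * kummerRoot V e P := by
  rcases T with _ | ⟨t, y, ht⟩
  · rw [← Affine.Point.zero_def, add_zero, kummerRoot_zero, one_mul]
  obtain rfl := (h.two_nsmul_some_eq_zero_iff h2 ht).mp hT
  rw [kummerRoot_some_zero]
  split_ifs with hte
  · subst hte
    obtain ⟨e', e'', h'⟩ := h.exists_first he
    rw [h'.kummerRoot_add_self h2, one_mul]
  · obtain ⟨s, h'⟩ := h.exists_third he ht.1 (Ne.symm hte)
    rw [h'.kummerRoot_add_of_ne h2, neg_one_mul]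

/-- The square of `kummerRoot` depends only on the double of the point. -/
theorem kummerRoot_sq_of_two_nsmul_eq_some (h2 : (2 : F) ≠ 0) (h : IsSplit V e₁ e₂ e₃)
    {x y : F} (hP : V.Nonsingular x y) (P₀ : V.Point) (hP₀ : 2 • P₀ = .some x y hP) :
    kummerRoot V e₁ P₀ ^ 2 = if x = e₁ then (e₁ - e₂) * (e₁ - e₃) else x - e₁ := by
  rcases P₀ with _ | ⟨x₀, y₀, h₀⟩
  · rw [← Affine.Point.zero_def, smul_zero] at hP₀
    exact absurd hP₀.symm (Affine.Point.some_ne_zero hP)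
  have hy : y₀ ≠ 0 := fun hy =>
    Affine.Point.some_ne_zero hP (hP₀ ▸ (h.two_nsmul_some_eq_zero_iff h2 h₀).mpr hy)
  have heq := (h.equation_iff x₀ y₀).mp h₀.1
  obtain ⟨h₃, H⟩ := h.two_nsmul_some h2 h₀ hy
    (m := ((x₀ - e₁) * (x₀ - e₂) + (x₀ - e₁) * (x₀ - e₃) + (x₀ - e₂) * (x₀ - e₃)) / (2 * y₀))
    (by field_simp) rfl rfl
  rw [H, Affine.Point.some.injEq] at hP₀
  -- The duplication formula in square form; it also shows that the exceptional branch occurs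
  -- exactly when x = e₁.
  have hx : x - e₁ = (((x₀ - e₁) ^ 2 - (e₁ - e₂) * (e₁ - e₃)) / (2 * y₀)) ^ 2 := by
    rw [← hP₀.1]
    field_simp
    rw [heq]
    ring
  rw [h.kummerRoot_some h₀ hy]
  by_cases hu : (x₀ - e₁) ^ 2 = (e₁ - e₂) * (e₁ - e₃)
  · rw [if_pos hu, if_pos, hu]
    rw [← sub_eq_zero, hx, hu, sub_self, zero_div, zero_pow two_ne_zero]
  · rw [if_neg hu, if_neg, hx]
    rw [← sub_eq_zero, hx]
    exact pow_ne_zero 2 (div_ne_zero (sub_ne_zero.mpr hu) (mul_ne_zero h2 hy))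

theorem kummerRoot_sq_of_two_nsmul_eq_zero (h2 : (2 : F) ≠ 0) (h : IsSplit V e₁ e₂ e₃) (e : F)
    (P₀ : V.Point) (hP₀ : 2 • P₀ = 0) : kummerRoot V e P₀ ^ 2 = 1 := by
  rcases P₀ with _ | ⟨x₀, y₀, h₀⟩
  · rw [← Affine.Point.zero_def, kummerRoot_zero, one_pow]
  obtain rfl := (h.two_nsmul_some_eq_zero_iff h2 h₀).mp hP₀
  rw [kummerRoot_some_zero]
  split_ifs <;> ring

end IsSplit

end SplitCurve

/-! ### Separability of the cubic and values of the Kummer polynomial -/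

section CubicRoots

variable {k : Type*} [Field k] {K : Type*} [Field K] [Algebra k K] {f : k[X]}

theorem eq_toPoly_of_natDegree_eq_three (hf : f.natDegree = 3) :
    f = Cubic.toPoly ⟨f.coeff 3, f.coeff 2, f.coeff 1, f.coeff 0⟩ := by
  conv_lhs => rw [f.as_sum_range_C_mul_X_pow, hf]
  simp [Finset.sum_range_succ, Cubic.toPoly]
  ring

theorem aeval_derivative_cubic (hf : f.natDegree = 3) (x : K) :
    aeval x f.derivative = algebraMap k K (f.coeff 1) + 2 * algebraMap k K (f.coeff 2) * x
      + 3 * algebraMap k K (f.coeff 3) * x ^ 2 := by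
  conv_lhs => rw [eq_toPoly_of_natDegree_eq_three hf]
  have h2 : algebraMap k K 2 = 2 := map_ofNat _ 2
  simp [Cubic.toPoly, h2]
  ring

theorem aeval_derivative_ne_zero (hf : f.natDegree = 3) [(cubicCurve f).IsElliptic] {x : K}
    (hx : aeval x f = 0) : aeval x f.derivative ≠ 0 := by
  have hcurve : cubicCurve (f.map (algebraMap k K)) = (cubicCurve f).map (algebraMap k K) := by
    simp [cubicCurve, WeierstrassCurve.map]
  have : (cubicCurve (f.map (algebraMap k K))).IsElliptic := by
    rw [hcurve]; infer_instance
  have hf' : (f.map (algebraMap k K)).natDegree = 3 := by rw [natDegree_map, hf]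
  have := eval_derivative_ne_zero hf' (x := x) (by rwa [eval_map_algebraMap])
  rwa [derivative_map, eval_map_algebraMap] at this

/-- A common root of f and f' in an algebraic closure would be a singular point. Separability lets f
split already over a separable closure. -/
theorem separable_of_isElliptic (hf : f.natDegree = 3) [(cubicCurve f).IsElliptic] :
    f.Separable := by
  refine (isCoprime_iff_aeval_ne_zero_of_isAlgClosed k (AlgebraicClosure k) _ _).mpr fun a => ?_
  by_cases ha : aeval a f = 0
  · exact Or.inr (aeval_derivative_ne_zero hf ha)
  · exact Or.inl ha

theorem exists_isSplit [IsSepClosed K] (hf : f.natDegree = 3) [(cubicCurve f).IsElliptic] :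
    ∃ e₁ e₂ e₃ : K, IsSplit ((cubicCurve f).toAffine.baseChange K) e₁ e₂ e₃ := by
  have hsep := separable_of_isElliptic hf
  have hc : algebraMap k K (f.coeff 3) ≠ 0 := by simpa using coeff_three_ne_zero hf
  have hcard : (f.map (algebraMap k K)).roots.card = 3 := by
    rw [← (IsSepClosed.splits_codomain f hsep).natDegree_eq_card_roots, natDegree_map, hf]
  obtain ⟨r₁, r₂, r₃, hr⟩ := Multiset.card_eq_three.mp hcard
  have hnd : ({r₁, r₂, r₃} : Multiset K).Nodup := hr ▸ nodup_roots hsep.map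
  simp only [Multiset.insert_eq_cons, Multiset.nodup_cons, Multiset.mem_cons,
    Multiset.mem_singleton, not_or, Multiset.nodup_singleton, and_true] at hnd
  set P : Cubic k := ⟨f.coeff 3, f.coeff 2, f.coeff 1, f.coeff 0⟩ with hP
  have hr' : (P.map (algebraMap k K)).roots = {r₁, r₂, r₃} := by
    rw [← hr, Cubic.map_roots, hP, ← eq_toPoly_of_natDegree_eq_three hf]
  have ha : P.a ≠ 0 := coeff_three_ne_zero hf
  have hb := Cubic.b_eq_three_roots ha hr'
  have hc' := Cubic.c_eq_three_roots ha hr'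
  have hd := Cubic.d_eq_three_roots ha hr'
  simp only [hP] at hb hc' hd
  -- The Weierstrass coordinate is X = c x, so the roots of f are scaled by c.
  refine ⟨algebraMap k K (f.coeff 3) * r₁, algebraMap k K (f.coeff 3) * r₂,
    algebraMap k K (f.coeff 3) * r₃, ?_, ?_, ?_, ?_, ?_, ?_, ?_, ?_⟩
  · simp [WeierstrassCurve.baseChange, WeierstrassCurve.map, cubicCurve]
  · simp [WeierstrassCurve.baseChange, WeierstrassCurve.map, cubicCurve]
  · simp only [WeierstrassCurve.baseChange, WeierstrassCurve.map, cubicCurve, hb]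
    ring
  · simp only [WeierstrassCurve.baseChange, WeierstrassCurve.map, cubicCurve, map_mul, hc']
    ring
  · simp only [WeierstrassCurve.baseChange, WeierstrassCurve.map, cubicCurve, map_mul, map_pow, hd]
    ring
  · exact fun h => hnd.1.1 (mul_left_cancel₀ hc h)
  · exact fun h => hnd.1.2 (mul_left_cancel₀ hc h)
  · exact fun h => hnd.2 (mul_left_cancel₀ hc h)

/-- The values of `kummerPoly` at the roots of `f`. -/
theorem aeval_kummerPoly [DecidableEq k] [DecidableEq K] {x : k} {r : K} (hr : aeval r f = 0) :
    aeval r (kummerPoly f x) = if algebraMap k K x = r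
      then algebraMap k K (f.coeff 3) * aeval r f.derivative
      else algebraMap k K (f.coeff 3) * (algebraMap k K x - r) := by
  unfold kummerPoly
  by_cases hx : f.eval x = 0
  · have hmul : (X - C x) * (f /ₘ (X - C x)) = f := mul_divByMonic_eq_iff_isRoot.mpr hx
    rw [if_pos hx]
    generalize f /ₘ (X - C x) = h at hmul
    split_ifs with hxr
    · subst hxr
      have hd : f.derivative = h + (X - C x) * derivative h := by
        rw [← hmul]
        simp
      simp [hd]
    · have h0 : aeval r h = 0 := by
        rw [← hmul, map_mul] at hr
        refine (mul_eq_zero.mp hr).resolve_left ?_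
        simpa [sub_eq_zero] using Ne.symm hxr
      simp [h0]
  · rw [if_neg hx, if_neg]
    · simp
    · rintro rfl
      rw [aeval_algebraMap_apply, coe_aeval_eq_eval] at hr
      exact hx (by simpa using hr)

end CubicRoots

/-! ### The 2-torsion points and their Weil pairing -/

section TwoTorsionPoints

variable {k : Type*} [Field k] {K : Type*} [Field K] [Algebra k K] {f : k[X]}

/-- The `X`-coordinate in the Weierstrass model of a point (and `0` for the point at infinity). -/
def xWeierstrass {V : Affine K} : V.Point → K
  | .zero => 0
  | .some X _ _ => X

theorem xWeierstrass_eq (hf : f.natDegree = 3) (P : Points (cubicCurve f) K) :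
    xWeierstrass P = algebraMap k K (f.coeff 3) * xCoord f P := by
  have hc : algebraMap k K (f.coeff 3) ≠ 0 := by simpa using coeff_three_ne_zero hf
  rcases P with _ | ⟨X, Y, h⟩
  · simp [xWeierstrass, xCoord]
  · simp only [xWeierstrass, xCoord]
    field_simp

theorem two_ne_zero_of_algebra (K : Type*) [Field K] [Algebra k K] (h2 : (2 : k) ≠ 0) :
    (2 : K) ≠ 0 := by
  rw [← map_ofNat (algebraMap k K) 2]
  exact (map_ne_zero (algebraMap k K)).mpr h2

section Split

variable [DecidableEq K] {W : WeierstrassCurve k} {e₁ e₂ e₃ : K}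

theorem two_nsmul_coe (T : TwoTorsion K W) : 2 • (T : Points W K) = 0 := by
  rw [← natCast_zsmul]
  exact mem_twoTorsion.mp T.2

theorem exists_eq_some (h2 : (2 : K) ≠ 0) (h : IsSplit (W.toAffine.baseChange K) e₁ e₂ e₃)
    {T : TwoTorsion K W} (hT : T ≠ 0) :
    ∃ hn, (T : Points W K) = .some (xWeierstrass (T : Points W K)) 0 hn := by
  have h0 := two_nsmul_coe T
  obtain ⟨T, hmem⟩ := T
  rcases T with _ | ⟨X, Y, hn⟩
  · exact absurd rfl hT
  · obtain rfl := (h.two_nsmul_some_eq_zero_iff h2 hn).mp h0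
    exact ⟨hn, rfl⟩

theorem equation_xWeierstrass (h2 : (2 : K) ≠ 0)
    (h : IsSplit (W.toAffine.baseChange K) e₁ e₂ e₃) {T : TwoTorsion K W} (hT : T ≠ 0) :
    (W.toAffine.baseChange K).Equation (xWeierstrass (T : Points W K)) 0 :=
  (exists_eq_some h2 h hT).1.1

theorem xWeierstrass_inj (h2 : (2 : K) ≠ 0)
    (h : IsSplit (W.toAffine.baseChange K) e₁ e₂ e₃) {S T : TwoTorsion K W} (hS : S ≠ 0)
    (hT : T ≠ 0) :
    xWeierstrass (S : Points W K) = xWeierstrass (T : Points W K) ↔ S = T := by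
  refine ⟨fun H => ?_, fun H => by rw [H]⟩
  obtain ⟨hn, hS⟩ := exists_eq_some h2 h hS
  obtain ⟨hm, hT⟩ := exists_eq_some h2 h hT
  apply Subtype.ext
  rw [hS, hT]
  simp only [H]

/-- The 2-torsion point with abscissa `e`. -/
theorem exists_twoTorsion (h2 : (2 : K) ≠ 0) (h : IsSplit (W.toAffine.baseChange K) e₁ e₂ e₃)
    {e : K} (he : (W.toAffine.baseChange K).Equation e 0) :
    ∃ T : TwoTorsion K W, T ≠ 0 ∧ xWeierstrass (T : Points W K) = e := by
  have hn := h.nonsingular h2 he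
  refine ⟨⟨.some e 0 hn, ?_⟩, fun H => ?_, rfl⟩
  · rw [mem_twoTorsion]
    exact_mod_cast (h.two_nsmul_some_eq_zero_iff h2 hn).mpr rfl
  · exact Affine.Point.some_ne_zero hn (congrArg Subtype.val H)

theorem exists_three_twoTorsion (h2 : (2 : K) ≠ 0)
    (h : IsSplit (W.toAffine.baseChange K) e₁ e₂ e₃) :
    ∃ T₁ T₂ T₃ : TwoTorsion K W, T₁ ≠ T₂ ∧ T₁ ≠ T₃ ∧ T₂ ≠ T₃ ∧
      ∀ T, T ≠ 0 ↔ T = T₁ ∨ T = T₂ ∨ T = T₃ := by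
  obtain ⟨T₁, n₁, h₁⟩ := exists_twoTorsion h2 h ((h.equation_zero_iff e₁).mpr (by simp))
  obtain ⟨T₂, n₂, h₂⟩ := exists_twoTorsion h2 h ((h.equation_zero_iff e₂).mpr (by simp))
  obtain ⟨T₃, n₃, h₃⟩ := exists_twoTorsion h2 h ((h.equation_zero_iff e₃).mpr (by simp))
  refine ⟨T₁, T₂, T₃, ?_, ?_, ?_, fun T => ⟨fun hT => ?_, ?_⟩⟩
  · rintro rfl; exact h.ne₁₂ (h₁.symm.trans h₂)
  · rintro rfl; exact h.ne₁₃ (h₁.symm.trans h₃)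
  · rintro rfl; exact h.ne₂₃ (h₂.symm.trans h₃)
  · rw [← xWeierstrass_inj h2 h hT n₁, ← xWeierstrass_inj h2 h hT n₂,
      ← xWeierstrass_inj h2 h hT n₃, h₁, h₂, h₃]
    exact (h.equation_zero_iff _).mp (equation_xWeierstrass h2 h hT)
  · rintro (rfl | rfl | rfl) <;> assumption

/-- On 2-torsion points, `kummerRoot` is the Weil pairing. -/
theorem kummerRoot_twoTorsion (h2 : (2 : K) ≠ 0)
    (h : IsSplit (W.toAffine.baseChange K) e₁ e₂ e₃) {T : TwoTorsion K W} (hT : T ≠ 0)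
    (S : TwoTorsion K W) [Decidable (S = 0 ∨ S = T)] :
    kummerRoot (W.toAffine.baseChange K) (xWeierstrass (T : Points W K)) (S : Points W K) =
      if S = 0 ∨ S = T then 1 else -1 := by
  by_cases hS : S = 0
  · rw [if_pos (Or.inl hS), hS]
    rfl
  · obtain ⟨hn, H⟩ := exists_eq_some h2 h hS
    rw [H, kummerRoot_some_zero]
    simp only [xWeierstrass_inj h2 h hS hT, hS, false_or]

/-- The Weil pairing is nondegenerate. -/
theorem eq_of_kummerRoot_eq (h2 : (2 : K) ≠ 0)
    (h : IsSplit (W.toAffine.baseChange K) e₁ e₂ e₃) {R S : TwoTorsion K W}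
    (H : ∀ T : TwoTorsion K W, T ≠ 0 →
      kummerRoot (W.toAffine.baseChange K) (xWeierstrass (T : Points W K)) (R : Points W K) =
      kummerRoot (W.toAffine.baseChange K) (xWeierstrass (T : Points W K)) (S : Points W K)) :
    R = S := by
  classical
  obtain ⟨T₁, T₂, T₃, h12, h13, h23, hT⟩ := exists_three_twoTorsion h2 h
  have hne : (1 : K) ≠ -1 := fun H => h2 (by linear_combination H)
  have n₁ := (hT T₁).mpr (by simp)
  have n₂ := (hT T₂).mpr (by simp)
  have n₃ := (hT T₃).mpr (by simp)
  have H₁ := H T₁ n₁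
  have H₂ := H T₂ n₂
  have H₃ := H T₃ n₃
  rw [kummerRoot_twoTorsion h2 h, kummerRoot_twoTorsion h2 h] at H₁ H₂ H₃ <;> try assumption
  by_cases hR : R = 0 <;> by_cases hS : S = 0
  · rw [hR, hS]
  · rcases (hT S).mp hS with rfl | rfl | rfl <;> simp_all [eq_comm]
  · rcases (hT R).mp hR with rfl | rfl | rfl <;> simp_all [eq_comm]
  · rcases (hT S).mp hS with rfl | rfl | rfl <;> rcases (hT R).mp hR with rfl | rfl | rfl <;>
      simp_all [eq_comm]

/-- Every sign function on the nonzero 2-torsion points is, up to a global sign, the Weil pairing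
with a 2-torsion point. -/
theorem exists_kummerRoot_eq_sign (h2 : (2 : K) ≠ 0)
    (h : IsSplit (W.toAffine.baseChange K) e₁ e₂ e₃) (ε : TwoTorsion K W → K)
    (hε : ∀ T, T ≠ 0 → ε T = 1 ∨ ε T = -1) :
    ∃ (s : k) (S : TwoTorsion K W), s ^ 2 = 1 ∧ ∀ T : TwoTorsion K W, T ≠ 0 →
      ε T = algebraMap k K s *
        kummerRoot (W.toAffine.baseChange K) (xWeierstrass (T : Points W K)) (S : Points W K) := by
  classical
  obtain ⟨T₁, T₂, T₃, h12, h13, h23, hT⟩ := exists_three_twoTorsion h2 h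
  have n₁ := (hT T₁).mpr (by simp)
  have n₂ := (hT T₂).mpr (by simp)
  have n₃ := (hT T₃).mpr (by simp)
  suffices ∃ (s : k) (S : TwoTorsion K W), s ^ 2 = 1 ∧ ∀ T : TwoTorsion K W, T ≠ 0 →
      ε T = algebraMap k K s * if S = 0 ∨ S = T then 1 else -1 by
    obtain ⟨s, S, hs, H⟩ := this
    exact ⟨s, S, hs, fun T hT => by rw [H T hT, kummerRoot_twoTorsion h2 h hT]⟩
  have key : ∀ (s : k) (S : TwoTorsion K W), s ^ 2 = 1 →
      (ε T₁ = algebraMap k K s * if S = 0 ∨ S = T₁ then 1 else -1) →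
      (ε T₂ = algebraMap k K s * if S = 0 ∨ S = T₂ then 1 else -1) →
      (ε T₃ = algebraMap k K s * if S = 0 ∨ S = T₃ then 1 else -1) →
      ∃ (s : k) (S : TwoTorsion K W), s ^ 2 = 1 ∧ ∀ T : TwoTorsion K W, T ≠ 0 →
      ε T = algebraMap k K s * if S = 0 ∨ S = T then 1 else -1 := by
    intro s S hs H₁ H₂ H₃
    refine ⟨s, S, hs, fun T h0 => ?_⟩
    rcases (hT T).mp h0 with rfl | rfl | rfl <;> assumption
  -- Each pairing function has product 1 over the three points, so s is the product of the three
  -- signs; S is then 0 or the point whose sign differs from the other two.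
  rcases hε T₁ n₁ with H₁ | H₁ <;> rcases hε T₂ n₂ with H₂ | H₂ <;>
    rcases hε T₃ n₃ with H₃ | H₃
  · exact key 1 0 (by simp) (by simp [H₁]) (by simp [H₂]) (by simp [H₃])
  · exact key (-1) T₃ (by simp) (by simp [*, h13.symm]) (by simp [*, h23.symm]) (by simp [*])
  · exact key (-1) T₂ (by simp) (by simp [*, h12.symm]) (by simp [*]) (by simp [*])
  · exact key 1 T₁ (by simp) (by simp [*]) (by simp [*]) (by simp [*])
  · exact key (-1) T₁ (by simp) (by simp [*]) (by simp [*]) (by simp [*])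
  · exact key 1 T₂ (by simp) (by simp [*, h12.symm]) (by simp [*]) (by simp [*])
  · exact key 1 T₃ (by simp) (by simp [*, h13.symm]) (by simp [*, h23.symm]) (by simp [*])
  · exact key (-1) 0 (by simp) (by simp [H₁]) (by simp [H₂]) (by simp [H₃])

end Split

end TwoTorsionPoints

/-! ### Galois action and rationality on the quotient -/

section GaloisAction

variable {k : Type*} [Field k] {K : Type*} [Field K] [Algebra k K] [DecidableEq K]
  {W : WeierstrassCurve k}

theorem xWeierstrass_galois (σ : K ≃ₐ[k] K) (P : Points W K) :
    xWeierstrass (galois W σ P) = σ (xWeierstrass P) := by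
  rcases P with _ | ⟨X, Y, h⟩
  · exact (map_zero σ).symm
  · rfl

theorem galois_symm_galois (σ : K ≃ₐ[k] K) (P : Points W K) :
    galois W σ.symm (galois W σ P) = P := by
  rcases P with _ | ⟨X, Y, h⟩
  · rfl
  · simp [galois, Affine.Point.map_some]

theorem galoisTwoTorsion_symm_apply (σ : K ≃ₐ[k] K) (T : TwoTorsion K W) :
    galoisTwoTorsion W σ (galoisTwoTorsion W σ.symm T) = T :=
  Subtype.ext (galois_symm_galois σ.symm (T : Points W K))

theorem galoisTwoTorsion_ne_zero (σ : K ≃ₐ[k] K) {T : TwoTorsion K W} (hT : T ≠ 0) :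
    galoisTwoTorsion W σ T ≠ 0 := fun H => hT <| by
  rw [← galoisTwoTorsion_symm_apply σ.symm T, AlgEquiv.symm_symm, H, map_zero]

theorem kummerRoot_galois (σ : K ≃ₐ[k] K) (e : K) (P : Points W K) :
    kummerRoot (W.toAffine.baseChange K) (σ e) (galois W σ P) =
      σ (kummerRoot (W.toAffine.baseChange K) e P) := by
  rcases P with _ | ⟨X, Y, h⟩
  · exact (map_one σ).symm
  · have hY : σ Y = 0 ↔ Y = 0 := map_eq_zero_iff σ σ.injective
    have h2 : σ 2 = 2 := map_ofNat σ 2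
    have h3 : σ 3 = 3 := map_ofNat σ 3
    have hB : 3 * σ e ^ 2 + 2 * algebraMap k K W.a₂ * σ e + algebraMap k K W.a₄
        = σ (3 * e ^ 2 + 2 * algebraMap k K W.a₂ * e + algebraMap k K W.a₄) := by
      simp [h2, h3]
    have hd : (σ X - σ e) ^ 2 = σ ((X - e) ^ 2) := by simp
    have key : ∀ b b' : K, b' = σ b →
        (if σ Y = 0 then if σ X = σ e then (1 : K) else -1
          else if (σ X - σ e) ^ 2 = b' then σ X - σ e
          else ((σ X - σ e) ^ 2 - b') / (2 * σ Y)) =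
        σ (if Y = 0 then if X = e then (1 : K) else -1
          else if (X - e) ^ 2 = b then X - e else ((X - e) ^ 2 - b) / (2 * Y)) := by
      rintro b _ rfl
      rw [hd]
      simp only [hY, σ.injective.eq_iff]
      split_ifs
      · rw [map_one]
      · rw [map_neg, map_one]
      · rw [map_sub]
      · rw [map_div₀, map_sub, map_mul, h2]
    exact key _ _ hB

theorem mem_range_ofBase [DecidableEq k] [IsGalois k K] {P : Points W K}
    (hP : ∀ σ : K ≃ₐ[k] K, galois W σ P = P) : P ∈ Set.range (ofBase K W) := by
  rcases P with _ | ⟨X, Y, h⟩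
  · exact ⟨0, rfl⟩
  · have hfix : ∀ σ : K ≃ₐ[k] K, σ X = X ∧ σ Y = Y := fun σ => by
      have := hP σ
      rwa [galois, Affine.Point.map_some, Affine.Point.some.injEq] at this
    obtain ⟨x, rfl⟩ := (InfiniteGalois.mem_range_algebraMap_iff_fixed X).mpr fun σ => (hfix σ).1
    obtain ⟨y, rfl⟩ := (InfiniteGalois.mem_range_algebraMap_iff_fixed Y).mpr fun σ => (hfix σ).2
    have hn : (W.toAffine.baseChange k).Nonsingular x y :=
      (W.toAffine.baseChange_nonsingular (Algebra.ofId k K).injective x y).mp h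
    exact ⟨.some x y hn, rfl⟩

theorem galois_ofBase [DecidableEq k] (σ : K ≃ₐ[k] K) (P : Points W k) :
    galois W σ (ofBase K W P) = ofBase K W P := by
  rcases P with _ | ⟨X, Y, h⟩
  · rfl
  · simp [galois, ofBase, Affine.Point.map_some, Algebra.ofId_apply]

variable {V : WeierstrassCurve k}

theorem TwoTorsionIso.isRational_proj_iff (ψ : TwoTorsionIso K V W) (P : Points V K)
    (Q : Points W K) :
    ψ.IsRational (ψ.proj (P, Q)) ↔ ∀ σ : K ≃ₐ[k] K, ∃ T : TwoTorsion K V,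
      galois V σ P = P + T ∧ galois W σ Q = Q + ψ.toAddEquiv T := by
  refine forall_congr' fun σ => ?_
  change ((galois V σ P, galois W σ Q) : ψ.Quotient) = ((P, Q) : Points V K × Points W K) ↔ _
  rw [eq_comm, QuotientAddGroup.eq, mem_graph]
  refine exists_congr fun T => ?_
  rw [eq_comm, Prod.ext_iff]
  simp only [Prod.fst_add, Prod.snd_add, Prod.fst_neg, Prod.snd_neg]
  rw [neg_add_eq_iff_eq_add, neg_add_eq_iff_eq_add]

end GaloisAction

/-! ### Galois descent for functions on the nonzero 2-torsion points -/

section Descent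

variable {k : Type*} [Field k] {K : Type*} [Field K] [Algebra k K] [DecidableEq K] {f : k[X]}

theorem evalAt_mk (h2 : (2 : k) ≠ 0) (hf : f.natDegree = 3) (T : TwoTorsion K (cubicCurve f))
    (hT : T ≠ 0) (p : k[X]) :
    evalAt h2 hf T hT (AdjoinRoot.mk f p) = aeval (xCoord f (T : Points (cubicCurve f) K)) p :=
  rfl

theorem xCoord_galois (σ : K ≃ₐ[k] K) (P : Points (cubicCurve f) K) :
    xCoord f (galois (cubicCurve f) σ P) = σ (xCoord f P) := by
  rcases P with _ | ⟨X, Y, h⟩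
  · exact (map_zero σ).symm
  · simp [galois, Affine.Point.map_some, xCoord]

theorem evalAt_galois (h2 : (2 : k) ≠ 0) (hf : f.natDegree = 3) (σ : K ≃ₐ[k] K)
    (T : TwoTorsion K (cubicCurve f)) (hT : T ≠ 0) (a : AdjoinRoot f) :
    evalAt h2 hf (galoisTwoTorsion _ σ T) (galoisTwoTorsion_ne_zero σ hT) a =
      σ (evalAt h2 hf T hT a) := by
  induction a using AdjoinRoot.induction_on with
  | ih p =>
    rw [evalAt_mk, evalAt_mk]
    change aeval (xCoord f (galois _ σ (T : Points (cubicCurve f) K))) p = _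
    rw [xCoord_galois]
    exact aeval_algHom_apply σ.toAlgHom _ p

variable [IsSepClosed K]

/-- The nonzero 2-torsion points form a set of three interpolation nodes. -/
theorem exists_nodes (h2 : (2 : k) ≠ 0) (hf : f.natDegree = 3) [(cubicCurve f).IsElliptic] :
    ∃ s : Finset (TwoTorsion K (cubicCurve f)), s.card = 3 ∧ (∀ T, T ∈ s ↔ T ≠ 0) ∧
      Set.InjOn (fun T : TwoTorsion K (cubicCurve f) =>
        xCoord f (T : Points (cubicCurve f) K)) s := by
  classical
  have h2K := two_ne_zero_of_algebra K h2
  obtain ⟨e₁, e₂, e₃, h⟩ := exists_isSplit (K := K) hf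
  obtain ⟨T₁, T₂, T₃, h12, h13, h23, hT⟩ := exists_three_twoTorsion h2K h
  have hmem : ∀ T, T ∈ ({T₁, T₂, T₃} : Finset _) ↔ T ≠ 0 := fun T => by
    rw [hT]
    simp
  refine ⟨{T₁, T₂, T₃}, Finset.card_eq_three.mpr ⟨_, _, _, h12, h13, h23, rfl⟩, hmem, ?_⟩
  intro S hS T hT H
  refine (xWeierstrass_inj h2K h ((hmem S).mp hS) ((hmem T).mp hT)).mp ?_
  rw [xWeierstrass_eq hf, xWeierstrass_eq hf]
  exact congrArg _ H

/-- An element of `k[T]/(f)` is determined by its values at the nonzero 2-torsion points. -/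
theorem evalAt_injective (h2 : (2 : k) ≠ 0) (hf : f.natDegree = 3) [(cubicCurve f).IsElliptic]
    {a b : AdjoinRoot f} (H : ∀ (T : TwoTorsion K (cubicCurve f)) (hT : T ≠ 0),
      evalAt h2 hf T hT a = evalAt h2 hf T hT b) : a = b := by
  obtain ⟨s, hs, hmem, hinj⟩ := exists_nodes (K := K) h2 hf
  obtain ⟨p, rfl⟩ := AdjoinRoot.mk_surjective a
  obtain ⟨q, rfl⟩ := AdjoinRoot.mk_surjective b
  have hf0 : f ≠ 0 := by
    rintro rfl
    simp at hf
  rw [AdjoinRoot.mk_eq_mk, ← EuclideanDomain.mod_eq_zero]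
  -- The remainder modulo f has degree below 3 and vanishes at three distinct nodes.
  have hdeg : (((p - q) % f).map (algebraMap k K)).degree < s.card := by
    rw [degree_map, hs, ← hf, ← degree_eq_natDegree hf0]
    exact EuclideanDomain.mod_lt (p - q) hf0
  have hzero := eq_zero_of_degree_lt_of_eval_index_eq_zero _ hinj hdeg fun T hTs => by
    have hT := (hmem T).mp hTs
    have h1 := H T hT
    rw [evalAt_mk, evalAt_mk, ← sub_eq_zero, ← map_sub,
      ← EuclideanDomain.div_add_mod (p - q) f, map_add, map_mul,
      aeval_xCoord_twoTorsion h2 hf T hT, zero_mul, zero_add] at h1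
    rwa [eval_map_algebraMap]
  exact (Polynomial.map_eq_zero (algebraMap k K)).mp hzero

/-- Galois descent: an equivariant function on the nonzero 2-torsion points comes from an element
of `k[T]/(f)`. -/
theorem exists_evalAt_eq [IsGalois k K] (h2 : (2 : k) ≠ 0) (hf : f.natDegree = 3)
    [(cubicCurve f).IsElliptic] (v : TwoTorsion K (cubicCurve f) → K)
    (hv : ∀ (σ : K ≃ₐ[k] K) (T : TwoTorsion K (cubicCurve f)), T ≠ 0 →
      v (galoisTwoTorsion _ σ T) = σ (v T)) :
    ∃ a : AdjoinRoot f, ∀ (T : TwoTorsion K (cubicCurve f)) (hT : T ≠ 0),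
      evalAt h2 hf T hT a = v T := by
  obtain ⟨s, hs, hmem, hinj⟩ := exists_nodes (K := K) h2 hf
  set x : TwoTorsion K (cubicCurve f) → K := fun T => xCoord f (T : Points (cubicCurve f) K)
  set p := Lagrange.interpolate s x v with hp
  have hdeg : p.degree < s.card := Lagrange.degree_interpolate_lt v hinj
  have heval : ∀ T ∈ s, p.eval (x T) = v T := fun T hT =>
    Lagrange.eval_interpolate_at_node v hinj hT
  -- Since the nodes and values are permuted compatibly, the conjugate of p solves the same
  -- interpolation problem; uniqueness puts the coefficients of p in k.
  have hfix : ∀ σ : K ≃ₐ[k] K, p.map (σ : K →+* K) = p := fun σ => by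
    refine eq_of_degrees_lt_of_eval_index_eq _ hinj (by rwa [degree_map]) hdeg ?_
    intro T hT
    rw [heval T hT]
    have h0 := (hmem T).mp hT
    have h0' := galoisTwoTorsion_ne_zero σ.symm h0
    have hT' := galoisTwoTorsion_symm_apply σ T
    have hxT : x T = σ (x (galoisTwoTorsion _ σ.symm T)) :=
      (congrArg x hT'.symm).trans (xCoord_galois σ _)
    calc (p.map (σ : K →+* K)).eval (x T)
        = (p.map (σ : K →+* K)).eval ((σ : K →+* K) (x (galoisTwoTorsion _ σ.symm T))) := by
          rw [hxT]; rfl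
      _ = σ (p.eval (x (galoisTwoTorsion _ σ.symm T))) := by rw [eval_map_apply]; rfl
      _ = σ (v (galoisTwoTorsion _ σ.symm T)) := by rw [heval _ ((hmem _).mpr h0')]
      _ = v T := by rw [← hv σ _ h0', hT']
  have hlift : p ∈ lifts (algebraMap k K) := (lifts_iff_coeff_lifts p).mpr fun n =>
    (InfiniteGalois.mem_range_algebraMap_iff_fixed _).mpr fun σ => by
      conv_rhs => rw [← hfix σ]
      rw [coeff_map]
      rfl
  obtain ⟨q, hq⟩ := (mem_lifts p).mp hlift
  refine ⟨AdjoinRoot.mk f q, fun T hT => ?_⟩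
  rw [evalAt_mk, ← heval T ((hmem T).mpr hT), ← hq, eval_map_algebraMap]

end Descent

/-! ### Square roots of Kummer classes and the cocycles they trivialize -/

section KummerSqrt

variable {k : Type*} [Field k] {K : Type*} [Field K] [Algebra k K] [DecidableEq K]

/-- `kummerRoot` at the abscissa of a 2-torsion point `T`. -/
def kummerSqrt {W : WeierstrassCurve k} (T : TwoTorsion K W) (P : Points W K) : K :=
  kummerRoot (W.toAffine.baseChange K) (xWeierstrass (T : Points W K)) P

theorem kummerSqrt_galois {W : WeierstrassCurve k} (σ : K ≃ₐ[k] K) (T : TwoTorsion K W)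
    (P : Points W K) :
    kummerSqrt (galoisTwoTorsion W σ T) (galois W σ P) = σ (kummerSqrt T P) := by
  rw [kummerSqrt, kummerSqrt, ← kummerRoot_galois, ← xWeierstrass_galois]
  rfl

/-- `kummerSqrt` trivializes the Kummer cocycle `σ ↦ σ P - P`. -/
theorem map_kummerSqrt {W : WeierstrassCurve k} {e₁ e₂ e₃ : K} (h2 : (2 : K) ≠ 0)
    (h : IsSplit (W.toAffine.baseChange K) e₁ e₂ e₃) (σ : K ≃ₐ[k] K) {T : TwoTorsion K W}
    (hT : T ≠ 0) {P : Points W K} {R : TwoTorsion K W} (hR : galois W σ P = P + R) :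
    σ (kummerSqrt T P) = kummerSqrt (galoisTwoTorsion W σ T) (R : Points W K) *
      kummerSqrt (galoisTwoTorsion W σ T) P := by
  rw [← kummerSqrt_galois, hR]
  exact h.kummerRoot_add h2 (equation_xWeierstrass h2 h (galoisTwoTorsion_ne_zero σ hT)) _ _
    (two_nsmul_coe R)

/-- An isomorphism of 2-torsion subgroups preserves the Weil pairing. -/
theorem kummerSqrt_map_map {V W : WeierstrassCurve k} {e₁ e₂ e₃ t₁ t₂ t₃ : K} (h2 : (2 : K) ≠ 0)
    (h : IsSplit (V.toAffine.baseChange K) e₁ e₂ e₃)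
    (h' : IsSplit (W.toAffine.baseChange K) t₁ t₂ t₃)
    (φ : TwoTorsion K V ≃+ TwoTorsion K W) {T : TwoTorsion K V} (hT : T ≠ 0)
    (R : TwoTorsion K V) :
    kummerSqrt (φ T) (φ R : Points W K) = kummerSqrt T (R : Points V K) := by
  classical
  rw [kummerSqrt, kummerSqrt, kummerRoot_twoTorsion h2 h hT,
    kummerRoot_twoTorsion h2 h' ((EmbeddingLike.map_ne_zero_iff).mpr hT)]
  simp only [EmbeddingLike.map_eq_zero_iff, EmbeddingLike.apply_eq_iff_eq]

variable {f : k[X]}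

/-- A representative of the Kummer image of `P` whose value at `T` is the square of
`kummerSqrt T P₀` for every half `P₀` of `P`. -/
theorem exists_kummer_eq_mk [IsSepClosed K] [DecidableEq k] (h2 : (2 : k) ≠ 0)
    (hf : f.natDegree = 3) [(cubicCurve f).IsElliptic] (P : Points (cubicCurve f) k) :
    ∃ u : (AdjoinRoot f)ˣ, kummer hf P = QuotientGroup.mk u ∧
      ∀ (T : TwoTorsion K (cubicCurve f)) (hT : T ≠ 0) (P₀ : Points (cubicCurve f) K),
        2 • P₀ = ofBase K (cubicCurve f) P →
          evalAt h2 hf T hT (u : AdjoinRoot f) = kummerSqrt T P₀ ^ 2 := by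
  have h2K := two_ne_zero_of_algebra K h2
  obtain ⟨e₁, e₂, e₃, h⟩ := exists_isSplit (K := K) hf
  rcases P with _ | ⟨X, Y, hP⟩
  · refine ⟨1, rfl, fun T hT P₀ hP₀ => ?_⟩
    rw [Units.val_one, map_one, kummerSqrt]
    exact (h.kummerRoot_sq_of_two_nsmul_eq_zero h2K _ P₀ hP₀).symm
  · refine ⟨_, rfl, fun T hT P₀ hP₀ => ?_⟩
    rw [IsUnit.unit_spec, evalAt_mk, aeval_kummerPoly (aeval_xCoord_twoTorsion h2 hf T hT)]
    obtain ⟨e', e'', h'⟩ := h.exists_first (equation_xWeierstrass h2K h hT)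
    have hc : algebraMap k K (f.coeff 3) ≠ 0 := by simpa using coeff_three_ne_zero hf
    have hx := xWeierstrass_eq hf (T : Points (cubicCurve f) K)
    have hX : algebraMap k K X = algebraMap k K (f.coeff 3) *
        algebraMap k K (xCoord f (Affine.Point.some X Y hP)) := by
      rw [← map_mul]
      congr 1
      simp only [xCoord, Algebra.algebraMap_self, RingHom.id_apply]
      rw [mul_div_cancel₀ _ (coeff_three_ne_zero hf)]
    have hsq := h'.kummerRoot_sq_of_two_nsmul_eq_some h2K _ P₀ hP₀
    have hiff : algebraMap k K X = xWeierstrass (T : Points (cubicCurve f) K) ↔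
        algebraMap k K (xCoord f (Affine.Point.some X Y hP)) =
          xCoord f (T : Points (cubicCurve f) K) := by
      rw [hX, hx, mul_right_inj' hc]
    -- The Weierstrass cubic is c² f(X/c), whose derivative is c f'(x); this accounts for the factor
    -- c in the 2-torsion component.
    have hB : algebraMap k K (f.coeff 3) *
          aeval (xCoord f (T : Points (cubicCurve f) K)) f.derivative =
        (xWeierstrass (T : Points (cubicCurve f) K) - e') *
          (xWeierstrass (T : Points (cubicCurve f) K) - e'') := by
      rw [← h'.derivative_eq, aeval_derivative_cubic hf, hx]
      simp only [WeierstrassCurve.baseChange, WeierstrassCurve.map, cubicCurve, map_mul]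
      ring
    rw [kummerSqrt, hsq, hB]
    change _ = if algebraMap k K X = xWeierstrass (T : Points (cubicCurve f) K) then _ else
      algebraMap k K X - xWeierstrass (T : Points (cubicCurve f) K)
    simp only [hiff]
    rw [hX, hx, ← mul_sub (algebraMap k K (f.coeff 3))]

theorem exists_two_nsmul_eq [IsSepClosed K] (h2 : (2 : k) ≠ 0) (hf : f.natDegree = 3)
    [(cubicCurve f).IsElliptic] (P : Points (cubicCurve f) K) :
    ∃ P₀ : Points (cubicCurve f) K, 2 • P₀ = P := by
  have h2K := two_ne_zero_of_algebra K h2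
  have : NeZero (2 : K) := ⟨h2K⟩
  obtain ⟨e₁, e₂, e₃, h⟩ := exists_isSplit (K := K) hf
  exact h.exists_two_nsmul h2K (fun a => IsSepClosed.exists_eq_mul_self a) P

end KummerSqrt

/-! ### The induced algebra isomorphism and the rationality criterion -/

section Gluing

variable {k : Type*} {K : Type*} [Field k] [Field K] [Algebra k K] [IsSepClosure k K]
  [DecidableEq K] {f g : k[X]}

/-- The function T ↦ x(ψ(T)) is equivariant, so it descends to an element of L, which is a root of g
because its values are. Sending the generator of L' to it is injective since ψ reaches every nonzero
point of F[2], and both algebras have dimension 3. -/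
theorem existsUnique_isInducedBy (h2 : (2 : k) ≠ 0) (hf : f.natDegree = 3) (hg : g.natDegree = 3)
    [(cubicCurve f).IsElliptic] [(cubicCurve g).IsElliptic]
    (ψ : TwoTorsionIso K (cubicCurve f) (cubicCurve g)) :
    ∃! θ : AdjoinRoot g ≃ₐ[k] AdjoinRoot f, IsInducedBy h2 hf hg ψ θ := by
  have : IsSepClosed K := IsSepClosure.sep_closed k
  obtain ⟨a, ha⟩ := exists_evalAt_eq h2 hf
    (fun T => xCoord g (ψ.toAddEquiv T : Points (cubicCurve g) K)) fun σ T _ => by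
      rw [← xCoord_galois]
      exact congrArg (fun S : TwoTorsion K (cubicCurve g) => xCoord g (S : Points _ K))
        (ψ.map_galois σ T)
  have hψ : ∀ {T}, T ≠ 0 → ψ.toAddEquiv T ≠ 0 := fun hT => (EmbeddingLike.map_ne_zero_iff).mpr hT
  have hroot : aeval a g = 0 := by
    refine evalAt_injective (K := K) h2 hf fun T hT => ?_
    rw [← aeval_algHom_apply, ha, map_zero]
    exact aeval_xCoord_twoTorsion h2 hg _ (hψ hT)
  let φ : AdjoinRoot g →ₐ[k] AdjoinRoot f := AdjoinRoot.liftAlgHom g (Algebra.ofId k _) a hroot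
  have hφ : ∀ (T : TwoTorsion K (cubicCurve f)) (hT : T ≠ 0) (b : AdjoinRoot g),
      evalAt h2 hf T hT (φ b) = evalAt h2 hg (ψ.toAddEquiv T) (hψ hT) b := by
    intro T hT b
    induction b using AdjoinRoot.induction_on with
    | ih p =>
      rw [evalAt_mk]
      change evalAt h2 hf T hT (aeval a p) = _
      rw [← aeval_algHom_apply, ha]
  have hinj : Function.Injective φ := fun b c hbc => by
    refine evalAt_injective (K := K) h2 hg fun S hS => ?_
    obtain ⟨T, rfl⟩ := ψ.toAddEquiv.surjective S
    have hT : T ≠ 0 := (EmbeddingLike.map_ne_zero_iff).mp hS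
    rw [← hφ T hT, ← hφ T hT, hbc]
  have hf0 : f ≠ 0 := by
    rintro rfl
    simp at hf
  have hg0 : g ≠ 0 := by
    rintro rfl
    simp at hg
  have := (AdjoinRoot.powerBasis hf0).finite
  have := (AdjoinRoot.powerBasis hg0).finite
  have hrank : Module.finrank k (AdjoinRoot g) = Module.finrank k (AdjoinRoot f) := by
    rw [(AdjoinRoot.powerBasis hf0).finrank, (AdjoinRoot.powerBasis hg0).finrank,
      AdjoinRoot.powerBasis_dim, AdjoinRoot.powerBasis_dim, hf, hg]
  have hsurj : Function.Surjective φ :=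
    (LinearMap.injective_iff_surjective_of_finrank_eq_finrank (f := φ.toLinearMap) hrank).mp hinj
  refine ⟨AlgEquiv.ofBijective φ ⟨hinj, hsurj⟩, hφ, fun θ hθ => AlgEquiv.ext fun b => ?_⟩
  refine evalAt_injective (K := K) h2 hf fun T hT => ?_
  rw [hθ T hT]
  exact (hφ T hT b).symm

theorem two_nsmul_mem_range_of_isRational [DecidableEq k] {V W : WeierstrassCurve k}
    (ψ : TwoTorsionIso K V W) {P₀ : Points V K} {Q₀ : Points W K}
    (h : ψ.IsRational (ψ.proj (P₀, Q₀))) :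
    2 • P₀ ∈ Set.range (ofBase K V) ∧ 2 • Q₀ ∈ Set.range (ofBase K W) := by
  rw [ψ.isRational_proj_iff] at h
  constructor <;> refine mem_range_ofBase fun σ => ?_ <;> obtain ⟨T, hP, hQ⟩ := h σ
  · rw [map_nsmul, hP, smul_add, two_nsmul_coe, add_zero]
  · rw [map_nsmul, hQ, smul_add, two_nsmul_coe, add_zero]

theorem exists_isRational_iff [DecidableEq k] (h2 : (2 : k) ≠ 0) (hf : f.natDegree = 3)
    (hg : g.natDegree = 3) [(cubicCurve f).IsElliptic] [(cubicCurve g).IsElliptic]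
    (ψ : TwoTorsionIso K (cubicCurve f) (cubicCurve g))
    (θ : AdjoinRoot g ≃ₐ[k] AdjoinRoot f) (hθ : IsInducedBy h2 hf hg ψ θ)
    (P : Points (cubicCurve f) k) (Q : Points (cubicCurve g) k) :
    (∃ (P₀ : Points (cubicCurve f) K) (Q₀ : Points (cubicCurve g) K),
      ψ.IsRational (ψ.proj (P₀, Q₀)) ∧ 2 • P₀ = ofBase K (cubicCurve f) P ∧
        2 • Q₀ = ofBase K (cubicCurve g) Q) ↔
      UnitsModSquares.map (θ : AdjoinRoot g →+* AdjoinRoot f) (kummer hg Q) = kummer hf P := by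
  have : IsSepClosed K := IsSepClosure.sep_closed k
  have h2K := two_ne_zero_of_algebra K h2
  obtain ⟨e₁, e₂, e₃, hE⟩ := exists_isSplit (K := K) hf
  obtain ⟨t₁, t₂, t₃, hF⟩ := exists_isSplit (K := K) hg
  obtain ⟨u, hu, hP⟩ := exists_kummer_eq_mk (K := K) h2 hf P
  obtain ⟨u', hu', hQ⟩ := exists_kummer_eq_mk (K := K) h2 hg Q
  have hψ : ∀ {T}, T ≠ 0 → ψ.toAddEquiv T ≠ 0 := fun hT => (EmbeddingLike.map_ne_zero_iff).mpr hT
  have hψσ : ∀ σ T, ψ.toAddEquiv (galoisTwoTorsion _ σ T) = galoisTwoTorsion _ σ (ψ.toAddEquiv T) :=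
    ψ.map_galois
  have hP0 : ∀ T, T ≠ 0 → ∀ P₀, 2 • P₀ = ofBase K (cubicCurve f) P → kummerSqrt T P₀ ≠ 0 :=
    fun T hT P₀ h => pow_ne_zero_iff two_ne_zero |>.mp
      (hP T hT P₀ h ▸ (u.isUnit.map (evalAt h2 hf T hT)).ne_zero)
  have hQ0 : ∀ T, T ≠ 0 → ∀ Q₀, 2 • Q₀ = ofBase K (cubicCurve g) Q → kummerSqrt T Q₀ ≠ 0 :=
    fun T hT Q₀ h => pow_ne_zero_iff two_ne_zero |>.mp
      (hQ T hT Q₀ h ▸ (u'.isUnit.map (evalAt h2 hg T hT)).ne_zero)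
  have hθ' : ∀ T hT Q₀, 2 • Q₀ = ofBase K (cubicCurve g) Q →
      evalAt h2 hf T hT (θ (u' : AdjoinRoot g)) = kummerSqrt (ψ.toAddEquiv T) Q₀ ^ 2 :=
    fun T hT Q₀ h => (hθ T hT _).trans (hQ _ (hψ hT) Q₀ h)
  rw [hu, hu']
  change _ ↔ (QuotientGroup.mk (Units.map (θ : AdjoinRoot g →+* AdjoinRoot f) u') :
    UnitsModSquares (AdjoinRoot f)) = QuotientGroup.mk u
  rw [QuotientGroup.eq]
  constructor
  · rintro ⟨P₀, Q₀, hrat, hP₀, hQ₀⟩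
    rw [ψ.isRational_proj_iff] at hrat
    -- Both square roots acquire the same pairing factor under σ, because the two cocycles
    -- correspond under ψ.
    have hequiv : ∀ (σ : K ≃ₐ[k] K) (T : TwoTorsion K (cubicCurve f)), T ≠ 0 →
        kummerSqrt (galoisTwoTorsion _ σ T) P₀ /
            kummerSqrt (ψ.toAddEquiv (galoisTwoTorsion _ σ T)) Q₀ =
          σ (kummerSqrt T P₀ / kummerSqrt (ψ.toAddEquiv T) Q₀) := by
      intro σ T hT
      obtain ⟨R, hRP, hRQ⟩ := hrat σ
      have hT' := galoisTwoTorsion_ne_zero σ hT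
      have hR : kummerSqrt (galoisTwoTorsion _ σ T) (R : Points (cubicCurve f) K) ≠ 0 := by
        intro H
        have := map_kummerSqrt h2K hE σ hT hRP
        rw [H, zero_mul] at this
        exact hP0 T hT P₀ hP₀ ((map_eq_zero σ).mp this)
      rw [map_div₀, map_kummerSqrt h2K hE σ hT hRP, map_kummerSqrt h2K hF σ (hψ hT) hRQ, ← hψσ,
        kummerSqrt_map_map h2K hE hF _ hT', mul_div_mul_left _ _ hR]
    obtain ⟨a, ha⟩ := exists_evalAt_eq h2 hf
      (fun T => kummerSqrt T P₀ / kummerSqrt (ψ.toAddEquiv T) Q₀) hequiv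
    obtain ⟨b, hb⟩ := exists_evalAt_eq h2 hf
      (fun T => (kummerSqrt T P₀ / kummerSqrt (ψ.toAddEquiv T) Q₀)⁻¹) fun σ T hT => by
        rw [map_inv₀, hequiv σ T hT]
    have hab : a * b = 1 := evalAt_injective (K := K) h2 hf fun T hT => by
      rw [map_mul, ha, hb, map_one]
      exact mul_inv_cancel₀ (div_ne_zero (hP0 T hT P₀ hP₀) (hQ0 _ (hψ hT) Q₀ hQ₀))
    refine ⟨⟨a, b, hab, by rw [mul_comm, hab]⟩, ?_⟩
    rw [eq_inv_mul_iff_mul_eq]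
    apply Units.ext
    change θ (u' : AdjoinRoot g) * a ^ 2 = u
    refine evalAt_injective (K := K) h2 hf fun T hT => ?_
    have := hQ0 _ (hψ hT) Q₀ hQ₀
    rw [map_mul, map_pow, ha, hθ' T hT Q₀ hQ₀, hP T hT P₀ hP₀]
    field_simp
  · rintro ⟨w, hw⟩
    rw [eq_inv_mul_iff_mul_eq] at hw
    have hw' : θ (u' : AdjoinRoot g) * (w : AdjoinRoot f) ^ 2 = u := congrArg Units.val hw
    obtain ⟨P₀, hP₀⟩ := exists_two_nsmul_eq h2 hf (ofBase K (cubicCurve f) P)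
    obtain ⟨Q₀, hQ₀⟩ := exists_two_nsmul_eq h2 hg (ofBase K (cubicCurve g) Q)
    classical
    have hsq : ∀ T hT, kummerSqrt T P₀ ^ 2 =
        (evalAt h2 hf T hT (w : AdjoinRoot f) * kummerSqrt (ψ.toAddEquiv T) Q₀) ^ 2 := by
      intro T hT
      rw [← hP T hT P₀ hP₀, ← hw', map_mul, map_pow, hθ' T hT Q₀ hQ₀]
      ring
    obtain ⟨s, S, hs, hS⟩ := exists_kummerRoot_eq_sign h2K hE
      (fun T => if hT : T ≠ 0 then
        (evalAt h2 hf T hT (w : AdjoinRoot f) * kummerSqrt (ψ.toAddEquiv T) Q₀) / kummerSqrt T P₀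
        else 1) fun T hT => by
          have h0 := hP0 T hT P₀ hP₀
          rw [dif_pos hT, ← sq_eq_one_iff, div_pow, ← hsq T hT]
          exact div_self (pow_ne_zero 2 h0)
    have hs0 : algebraMap k K s ^ 2 = 1 := by rw [← map_pow, hs, map_one]
    have hP₁ : 2 • (P₀ + S) = ofBase K (cubicCurve f) P := by
      rw [smul_add, two_nsmul_coe, add_zero, hP₀]
    have hval : ∀ T hT, kummerSqrt T (P₀ + (S : Points (cubicCurve f) K)) = algebraMap k K s *
        (evalAt h2 hf T hT (w : AdjoinRoot f) * kummerSqrt (ψ.toAddEquiv T) Q₀) := by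
      intro T hT
      have hadd : kummerSqrt T (P₀ + (S : Points (cubicCurve f) K)) =
          kummerSqrt T (S : Points (cubicCurve f) K) * kummerSqrt T P₀ :=
        hE.kummerRoot_add h2K (equation_xWeierstrass h2K hE hT) _ _ (two_nsmul_coe S)
      have h1 := hS T hT
      rw [dif_pos hT, div_eq_iff (hP0 T hT P₀ hP₀)] at h1
      rw [hadd, h1]
      change _ = _ * (algebraMap k K s * kummerSqrt T (S : Points (cubicCurve f) K) * _)
      linear_combination (-kummerSqrt T (S : Points (cubicCurve f) K) * kummerSqrt T P₀) * hs0
    refine ⟨P₀ + S, Q₀, ?_, hP₁, hQ₀⟩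
    rw [ψ.isRational_proj_iff]
    intro σ
    have hdiff : ∀ {W : WeierstrassCurve k} {A : Points W K} {B : Points W k},
        2 • A = ofBase K W B → ∃ R : TwoTorsion K W, galois W σ A = A + R := by
      intro W A B hAB
      refine ⟨⟨galois W σ A - A, ?_⟩, by simp⟩
      rw [mem_twoTorsion, smul_sub, sub_eq_zero]
      have : 2 • galois W σ A = 2 • A := by rw [← map_nsmul, hAB, galois_ofBase]
      exact_mod_cast this
    obtain ⟨R, hR⟩ := hdiff hP₁
    obtain ⟨R', hR'⟩ := hdiff hQ₀
    refine ⟨R, hR, ?_⟩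
    obtain ⟨R'', rfl⟩ := ψ.toAddEquiv.surjective R'
    rw [hR']
    suffices R = R'' by rw [this]
    -- Applying σ to `hval` compares the pairings of R and R'' with each σT: s is fixed, w is
    -- equivariant, and the nonzero square root cancels.
    refine eq_of_kummerRoot_eq h2K hE fun T' hT' => ?_
    obtain ⟨T, hT, rfl⟩ : ∃ T, T ≠ 0 ∧ galoisTwoTorsion _ σ T = T' :=
      ⟨_, galoisTwoTorsion_ne_zero σ.symm hT', galoisTwoTorsion_symm_apply σ T'⟩
    change kummerSqrt _ _ = kummerSqrt _ _
    have key := map_kummerSqrt h2K hE σ hT hR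
    have key' := map_kummerSqrt h2K hF σ (hψ hT) hR'
    rw [← hψσ, kummerSqrt_map_map h2K hE hF _ hT'] at key'
    have hne := hP0 _ hT' _ hP₁
    refine mul_right_cancel₀ hne ?_
    rw [← key, hval T hT, hval _ hT', map_mul, map_mul, key', evalAt_galois h2 hf σ T hT,
      AlgEquiv.commutes]
    ring

end Gluing

end TwoGluing

theorem mainTheorem7 {k : Type*} {K : Type*} [Field k] [Field K] [Algebra k K]
    [IsSepClosure k K] [DecidableEq k] [DecidableEq K] (h2 : (2 : k) ≠ 0)
    (f g : Polynomial k) (hf : f.natDegree = 3) (hg : g.natDegree = 3)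
    [(TwoGluing.cubicCurve f).IsElliptic] [(TwoGluing.cubicCurve g).IsElliptic]
    (ψ : TwoGluing.TwoTorsionIso K (TwoGluing.cubicCurve f) (TwoGluing.cubicCurve g)) :
    (∃! θ : AdjoinRoot g ≃ₐ[k] AdjoinRoot f, TwoGluing.IsInducedBy h2 hf hg ψ θ) ∧
    (∀ (P₀ : TwoGluing.Points (TwoGluing.cubicCurve f) K)
      (Q₀ : TwoGluing.Points (TwoGluing.cubicCurve g) K),
      ψ.IsRational (ψ.proj (P₀, Q₀)) →
        2 • P₀ ∈ Set.range (TwoGluing.ofBase K (TwoGluing.cubicCurve f)) ∧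
        2 • Q₀ ∈ Set.range (TwoGluing.ofBase K (TwoGluing.cubicCurve g))) ∧
    (∀ θ : AdjoinRoot g ≃ₐ[k] AdjoinRoot f, TwoGluing.IsInducedBy h2 hf hg ψ θ →
      ∀ (P : TwoGluing.Points (TwoGluing.cubicCurve f) k)
        (Q : TwoGluing.Points (TwoGluing.cubicCurve g) k),
        (∃ (P₀ : TwoGluing.Points (TwoGluing.cubicCurve f) K)
          (Q₀ : TwoGluing.Points (TwoGluing.cubicCurve g) K),
          ψ.IsRational (ψ.proj (P₀, Q₀)) ∧
          2 • P₀ = TwoGluing.ofBase K (TwoGluing.cubicCurve f) P ∧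
          2 • Q₀ = TwoGluing.ofBase K (TwoGluing.cubicCurve g) Q) ↔
        TwoGluing.UnitsModSquares.map (θ : AdjoinRoot g →+* AdjoinRoot f)
          (TwoGluing.kummer hg Q) = TwoGluing.kummer hf P) :=
  ⟨TwoGluing.existsUnique_isInducedBy h2 hf hg ψ,
    fun _ _ => TwoGluing.two_nsmul_mem_range_of_isRational ψ,
    fun θ hθ P Q => TwoGluing.exists_isRational_iff h2 hf hg ψ θ hθ P Q⟩
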